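/- Let $X$ be a compact metric space, $\mathcal F=(f_t)_{t\in\mathbb R}$ a continuous flow on $X$ and $\varphi:X\to\mathbb R$ continuous. Let $X\times X$ carry the maximum metric and the flow $\mathcal F\times\mathcal F=(f_t\times f_t)_{t\in\mathbb R}$, and put $\Phi(x,y)=\varphi(x)+\varphi(y)$. Notation, for a continuous flow $\mathcal G=(g_t)$ on a compact metric space $(Y,d)$ and a continuous $\psi:Y\to\mathbb R$: - For a $\mathcal G$-invariant Borel probability measure $\mu$, $P_\mu(\psi)=h_\mu(g_1)+\int\psi\,d\mu$, where $h_\mu(g_1)\in[0,\infty]$ is the Kolmogorov–Sinai entropy of the time-one map. - $P(\psi)=\lim_{\varepsilon\to0}\limsup_{t\to\infty}\frac1t\log\sup_E\sum_{x\in E}e^{\int_0^t\psi(g_sx)\,ds}$ is the topological pressure, where $E$ runs over the $(t,\varepsilon)$-separated subsets of $Y$, i.e. those in which any two distinct points $x,y$ satisfy $d(g_sx,g_sy)\ge\varepsilon$ for some $s\in[0,t]$. - An equilibrium state of $\psi$ is a $\mathcal G$-invariant Borel probability measure $\mu$ with $P_\mu(\psi)=P(\psi)$. - $\Gamma_\varepsilon(x)=\{y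 : d(g_tx,g_ty)\le\varepsilon\ \text{for all } t\in\mathbb R\}$ and $g_{[-s,s]}(x)=\{g_tx : |t|\le s\}$. For the flow $\mathcal F$ let $\mathrm{NE}(\varepsilon)=\{x\in X:\Gamma_\varepsilon(x)\not\subset f_{[-s,s]}(x)\text{ for all }s>0\}$ and $$P_{\exp}^\perp(\varphi)=\lim_{\varepsilon\downarrow0}\ \sup\{P_\mu(\varphi) : \mu \text{ an } \mathcal F\text{-invariant Borel probability measure with } \mu(\mathrm{NE}(\varepsilon))=1\}\qquad(\sup\emptyset=-\infty).$$ For $\mathcal F\times\mathcal F$ let $$\mathrm{NE}^\times(\varepsilon)=\{(x,y)\in X\times X:\Gamma_\varepsilon((x,y))\not\subset f_{[-s,s]}(x)\times f_{[-s,s]}(y)\text{ for all }s>0\}.$$ A Borel probability measure $\nu$ on $X\times X$ is product expansive if $\nu(\mathrm{NE}^\times(\varepsilon))=0$ for all sufficiently small $\varepsilon>0$. Pressures take values in $[-\infty,\infty]$. Then: 1. Every ergodic $(\mathcal F\times\mathcal F)$-invariant Borel probability measure $\nu$ on $X\times X$ that is not product expansive satisfies $P_\nu(\Phi)\le P_{\exp}^\perp(\varphi)+P(\varphi)$.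 2. If $P_{\exp}^\perp(\varphi)<P(\varphi)$, then every equilibrium state of $\Phi$ for $\mathcal F\times\mathcal F$ (ergodic or not) is product expansive. -/

import Mathlib

open Set Filter Topology MeasureTheory

namespace FlowPressure

noncomputable section

/-! ### Measure-theoretic entropy and pressure -/

section Entropy

variable {X : Type*} [MeasurableSpace X]

/-- Shannon entropy `H_μ(ξ) = -∑ⱼ μ(ξ⁻¹{j}) log μ(ξ⁻¹{j})` of the finite partition of `X` into the
fibres of `ξ : X → ι` (empty cells contribute `0`). -/
def partitionEntropy {ι : Type*} [Fintype ι] (μ : Measure X) (ξ : X → ι) : ℝ :=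
  ∑ j, Real.negMulLog (μ.real (ξ ⁻¹' {j}))

/-- The map whose fibres are the cells of `⋁_{i < n} T⁻ⁱ ξ`. -/
def refinement {ι : Type*} (T : X → X) (ξ : X → ι) (n : ℕ) : X → (Fin n → ι) :=
  fun x i => ξ (T^[i] x)

/-- Entropy of the partition `ξ` with respect to `T`: the limit of
`(1/n) H_μ(⋁_{i < n} T⁻ⁱ ξ)`. For `T`-invariant probability measures the limit exists by
subadditivity, so it is the `limsup`. -/
def partitionEntropyRate {ι : Type*} [Fintype ι] (μ : Measure X) (T : X → X) (ξ : X → ι) : EReal :=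
  limsup (fun n : ℕ => ((partitionEntropy μ (refinement T ξ n) / (n : ℝ) : ℝ) : EReal)) atTop

/-- Kolmogorov–Sinai entropy `h_μ(T)`: the supremum over all finite measurable partitions. -/
def entropy (μ : Measure X) (T : X → X) : EReal :=
  ⨆ (k : ℕ) (ξ : X → Fin k) (_ : Measurable ξ), partitionEntropyRate μ T ξ

end Entropy

section Measures

variable {X : Type*} [TopologicalSpace X] [MeasurableSpace X]

/-- `μ` is a flow-invariant probability measure. -/
structure IsInvariantProb (F : Flow ℝ X) (μ : Measure X) : Prop where
  isProbabilityMeasure : IsProbabilityMeasure μ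
  measurePreserving : ∀ t : ℝ, MeasurePreserving (F t) μ μ

/-- `μ` is an ergodic flow-invariant probability measure. -/
structure IsErgodicProb (F : Flow ℝ X) (μ : Measure X) : Prop extends IsInvariantProb F μ where
  zero_or_one : ∀ A : Set X, MeasurableSet A → (∀ t : ℝ, F t ⁻¹' A = A) → μ A = 0 ∨ μ A = 1

/-- `P_μ(φ) = h_μ(f₁) + ∫ φ dμ`, where the entropy of a flow is that of its time-one map. -/
def measurePressure (F : Flow ℝ X) (φ : X → ℝ) (μ : Measure X) : EReal :=
  entropy μ (F 1) + ((∫ x, φ x ∂μ : ℝ) : EReal)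

end Measures

/-! ### Topological pressure -/

section TopologicalPressure

variable {X : Type*} [MetricSpace X]

/-- `E` is `(t, ε)`-separated. -/
def IsSeparated (F : Flow ℝ X) (t ε : ℝ) (E : Set X) : Prop :=
  ∀ x ∈ E, ∀ y ∈ E, x ≠ y → ∃ s ∈ Icc (0 : ℝ) t, ε ≤ dist (F s x) (F s y)

/-- `Λ_t(φ, ε)`: the supremum of `∑_{x ∈ E} exp (∫₀ᵗ φ(f_s x) ds)` over `(t, ε)`-separated sets `E`.
(On a compact space every `(t, ε)`-separated set is finite.) -/
def partitionSum (F : Flow ℝ X) (φ : X → ℝ) (t ε : ℝ) : ENNReal :=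
  ⨆ (E : Finset X) (_ : IsSeparated F t ε (E : Set X)),
    ∑ x ∈ E, ENNReal.ofReal (Real.exp (∫ s in (0 : ℝ)..t, φ (F s x)))

/-- `P(φ, ε) = limsup_{t → ∞} (1/t) log Λ_t(φ, ε)`. -/
def pressureAtScale (F : Flow ℝ X) (φ : X → ℝ) (ε : ℝ) : EReal :=
  limsup (fun t : ℝ => ENNReal.log (partitionSum F φ t ε) / (t : EReal)) atTop

/-- Topological pressure `P(φ) = lim_{ε → 0} P(φ, ε)`; as `P(φ, ε)` is nonincreasing in `ε`, the
limit is the supremum over `ε > 0`. -/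
def topPressure (F : Flow ℝ X) (φ : X → ℝ) : EReal :=
  ⨆ (ε : ℝ) (_ : 0 < ε), pressureAtScale F φ ε

/-- An equilibrium state: an invariant probability measure with `P_μ(φ) = P(φ)`. -/
def IsEquilibriumState [MeasurableSpace X] (F : Flow ℝ X) (φ : X → ℝ) (μ : Measure X) : Prop :=
  IsInvariantProb F μ ∧ measurePressure F φ μ = topPressure F φ

end TopologicalPressure

/-! ### Expansivity -/

section Expansivity

variable {X : Type*} [MetricSpace X]

/-- `Γ_ε(x)`: the points that `ε`-shadow `x` for all time. -/
def shadowSet (F : Flow ℝ X) (ε : ℝ) (x : X) : Set X :=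
  {y | ∀ t : ℝ, dist (F t x) (F t y) ≤ ε}

/-- The orbit segment `f_{[-s,s]}(x)`. -/
def orbitSegment (F : Flow ℝ X) (s : ℝ) (x : X) : Set X :=
  (fun t : ℝ => F t x) '' Icc (-s) s

/-- `NE(ε)`: the non-expansive points at scale `ε`. -/
def nonExpansiveSet (F : Flow ℝ X) (ε : ℝ) : Set X :=
  {x | ∀ s : ℝ, 0 < s → ¬ shadowSet F ε x ⊆ orbitSegment F s x}

/-- Pressure of obstructions to expansivity:
`lim_{ε ↓ 0} sup {P_μ(φ) | μ invariant probability, μ(NE(ε)) = 1}`. As `NE(ε)` is nondecreasing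
in `ε`, so is the supremum (which is `⊥ = -∞` if there is no such `μ`), and the limit is the infimum
over `ε > 0`. -/
def obstructionPressure [MeasurableSpace X] (F : Flow ℝ X) (φ : X → ℝ) : EReal :=
  ⨅ (ε : ℝ) (_ : 0 < ε),
    ⨆ (μ : Measure X) (_ : IsInvariantProb F μ) (_ : μ (nonExpansiveSet F ε) = 1),
      measurePressure F φ μ

/-- The product flow `(f_t × f_t)` on `X × X`. -/
def prodFlow (F : Flow ℝ X) : Flow ℝ (X × X) where
  toFun t p := (F t p.1, F t p.2)
  cont' := by
    have h1 : Continuous fun q : ℝ × (X × X) => F q.1 q.2.1 :=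
      F.continuous continuous_fst (continuous_fst.comp continuous_snd)
    have h2 : Continuous fun q : ℝ × (X × X) => F q.1 q.2.2 :=
      F.continuous continuous_fst (continuous_snd.comp continuous_snd)
    exact h1.prodMk h2
  map_add' t₁ t₂ p := by simp [F.map_add]
  map_zero' p := by simp

/-- `Φ(x, y) = φ(x) + φ(y)`. -/
def prodPotential (φ : X → ℝ) : X × X → ℝ := fun p => φ p.1 + φ p.2

/-- `NE^×(ε)`: the product non-expansive set, where `X × X` has the maximum metric. -/
def prodNonExpansiveSet (F : Flow ℝ X) (ε : ℝ) : Set (X × X) :=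
  {p | ∀ s : ℝ, 0 < s →
    ¬ shadowSet (prodFlow F) ε p ⊆ orbitSegment F s p.1 ×ˢ orbitSegment F s p.2}

/-- `ν` is product expansive: `ν(NE^×(ε)) = 0` for all small `ε > 0`. -/
def IsProductExpansive [MeasurableSpace X] (F : Flow ℝ X) (ν : Measure (X × X)) : Prop :=
  ∀ᶠ ε in 𝓝[>] (0 : ℝ), ν (prodNonExpansiveSet F ε) = 0

end Expansivity

end

end FlowPressure

/-!
A point `(x, y)` is product non-expansive at scale `ε` only if `x` or `y` is non-expansive at scale
`ε`, because `Γ_ε((x, y)) = Γ_ε(x) × Γ_ε(y)` for the maximum metric. The set `NE(ε)` is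
flow-invariant and Borel. Hence a measure `ν` which is not product expansive charges, for every
`ε`, one of the invariant sets `NE(ε) × X` and `X × NE(ε)`, and if `ν` is ergodic one of its
marginals is carried by `NE(ε)` for all `ε`. The first assertion follows from

* `measurePressure_prodFlow_le`: `P_ν(Φ)` is at most the sum of the pressures of the marginals,
  since the entropy of a joining is subadditive;
* `measurePressure_le_topPressure`: the pressure of an invariant measure is at most the topological
  pressure (one half of the variational principle, by Misiurewicz' argument).

For the second assertion no ergodic decomposition is needed. Choose `ε` such that the measures on
`NE(ε)` have pressure at most `s < P(φ)`. If `ν` is not product expansive, condition it on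
`B = NE(ε) × X` (or `X × NE(ε)`), with `ν(B) = a > 0`, and on the complement of `B`. Pressure is
convex for this splitting (`measurePressure_le_of_cond_le`), so that
`P_ν(Φ) ≤ a (s + P(φ)) + (1 - a) 2 P(φ) < 2 P(φ) ≤ P(Φ)`, the last step by
`two_mul_le_topPressure_prodFlow`.

The strict inequality requires `P(φ) < ∞`. An invariant measure which does not charge `NE(ε)` has
finite entropy (`entropy_lt_top_of_measure_nonExpansiveSet_eq_zero`), so that every invariant
measure has finite pressure as soon as those on `NE(ε)` have bounded pressure
(`measurePressure_lt_top`). Applied to the marginals of an equilibrium state `ν` of `Φ`, this gives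
`2 P(φ) ≤ P(Φ) = P_ν(Φ) < ∞`.
-/

namespace FlowPressure

/-! ### Shannon entropy of finite partitions -/

/-- Subadditivity of `-x log x` over a finite set. -/
lemma negMulLog_sum_le {ι : Type*} (s : Finset ι) (p : ι → ℝ) (hp : ∀ i ∈ s, 0 ≤ p i) :
    Real.negMulLog (∑ i ∈ s, p i) ≤ ∑ i ∈ s, Real.negMulLog (p i) := by
  simp only [Real.negMulLog, neg_mul, Finset.sum_mul, Finset.sum_neg_distrib, neg_le_neg_iff]
  refine Finset.sum_le_sum fun i hi => ?_
  rcases (hp i hi).eq_or_lt with h0 | h0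
  · simp [← h0]
  · exact mul_le_mul_of_nonneg_left
      (Real.log_le_log h0 (Finset.single_le_sum hp hi)) h0.le

/-- Gibbs' inequality: among the weights `p` of total mass `P` on `s`, the quantity
`∑ (-p log p + p u)` is largest for `p` proportional to `exp u`. -/
lemma sum_negMulLog_add_le {ι : Type*} (s : Finset ι) (p u : ι → ℝ) (hp : ∀ i ∈ s, 0 ≤ p i) :
    ∑ i ∈ s, (Real.negMulLog (p i) + p i * u i) ≤
      Real.negMulLog (∑ i ∈ s, p i) + (∑ i ∈ s, p i) * Real.log (∑ i ∈ s, Real.exp (u i)) := by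
  rcases s.eq_empty_or_nonempty with rfl | hs
  · simp
  set P := ∑ i ∈ s, p i with hP
  set Z := ∑ i ∈ s, Real.exp (u i) with hZ
  have hZ0 : 0 < Z := Finset.sum_pos (fun i _ => Real.exp_pos _) hs
  have hP0 : 0 ≤ P := Finset.sum_nonneg hp
  have key : ∀ i ∈ s, Real.negMulLog (p i) + p i * u i
      ≤ p i * (Real.log Z - Real.log P) + (Real.exp (u i) / Z * P - p i) := by
    intro i hi
    rcases (hp i hi).eq_or_lt with h0 | h0
    · simp only [← h0, Real.negMulLog_zero, zero_mul, zero_add, sub_zero]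
      positivity
    have hPpos : 0 < P := h0.trans_le (Finset.single_le_sum hp hi)
    have h1 : Real.log (Real.exp (u i) / Z * P / p i)
        = u i - Real.log Z + Real.log P - Real.log (p i) := by
      rw [Real.log_div (by positivity) h0.ne', Real.log_mul (by positivity) hPpos.ne',
        Real.log_div (Real.exp_pos _).ne' hZ0.ne', Real.log_exp]
    have h2 := Real.log_le_sub_one_of_pos (x := Real.exp (u i) / Z * P / p i) (by positivity)
    rw [h1] at h2
    have h3 := mul_le_mul_of_nonneg_left h2 h0.le
    have h4 : p i * (Real.exp (u i) / Z * P / p i - 1) = Real.exp (u i) / Z * P - p i := by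
      field_simp
    rw [h4] at h3
    simp only [Real.negMulLog]
    linarith
  refine (Finset.sum_le_sum key).trans (le_of_eq ?_)
  rw [Finset.sum_add_distrib, ← Finset.sum_mul, Finset.sum_sub_distrib, ← Finset.sum_mul,
    ← Finset.sum_div, ← hP, ← hZ, div_self hZ0.ne', Real.negMulLog]
  ring

/-- Conditional entropy `H_μ(ξ | η) = H_μ(ξ ∨ η) - H_μ(η)`. -/
noncomputable def condEntropy {X : Type*} [MeasurableSpace X] {ι κ : Type*} [Fintype ι] [Fintype κ]
    (μ : Measure X) (ξ : X → ι) (η : X → κ) : ℝ :=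
  partitionEntropy μ (fun x => (ξ x, η x)) - partitionEntropy μ η

lemma sum_real_preimage {X ι : Type*} [MeasurableSpace X] {μ : Measure X} [IsFiniteMeasure μ]
    [MeasurableSpace ι] [MeasurableSingletonClass ι] {ξ : X → ι} (hξ : Measurable ξ)
    (s : Finset ι) : ∑ i ∈ s, μ.real (ξ ⁻¹' {i}) = μ.real (ξ ⁻¹' s) :=
  sum_measureReal_preimage_singleton s fun _ _ => hξ (measurableSet_singleton _)

section Entropy

variable {X : Type*} [MeasurableSpace X] {ι κ τ : Type*}
  [Fintype ι] [MeasurableSpace ι] [MeasurableSingletonClass ι]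
  [Fintype κ] [MeasurableSpace κ] [MeasurableSingletonClass κ]
  [Fintype τ] [MeasurableSpace τ] [MeasurableSingletonClass τ]
  {μ : Measure X}

lemma sum_real_fibre [IsProbabilityMeasure μ] {ξ : X → ι} (hξ : Measurable ξ) :
    ∑ i, μ.real (ξ ⁻¹' {i}) = 1 := by
  rw [sum_real_preimage hξ]; simp

lemma sum_real_pair_left {β : Type*} [MeasurableSpace β] [MeasurableSingletonClass β]
    [IsFiniteMeasure μ] {ξ : X → ι} {η : X → β} (hξ : Measurable ξ) (hη : Measurable η) (b : β) :
    ∑ a, μ.real ((fun x => (ξ x, η x)) ⁻¹' {(a, b)}) = μ.real (η ⁻¹' {b}) := by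
  have h := sum_real_preimage (μ := μ) (hξ.prodMk hη) (Finset.univ ×ˢ {b})
  rw [Finset.sum_product] at h
  simp only [Finset.sum_singleton] at h
  rw [h]
  congr 1
  ext x
  simp [eq_comm]

lemma sum_real_pair_right {β : Type*} [MeasurableSpace β] [MeasurableSingletonClass β]
    [IsFiniteMeasure μ] {ξ : X → β} {η : X → κ} (hξ : Measurable ξ) (hη : Measurable η) (a : β) :
    ∑ b, μ.real ((fun x => (ξ x, η x)) ⁻¹' {(a, b)}) = μ.real (ξ ⁻¹' {a}) := by
  have h := sum_real_preimage (μ := μ) (hξ.prodMk hη) ({a} ×ˢ Finset.univ)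
  rw [Finset.sum_product] at h
  simp only [Finset.sum_singleton] at h
  rw [h]
  congr 1
  ext x
  simp [eq_comm]

lemma partitionEntropy_nonneg {α : Type*} [Fintype α] [IsProbabilityMeasure μ] (ξ : X → α) :
    0 ≤ partitionEntropy μ ξ :=
  Finset.sum_nonneg fun _ _ => Real.negMulLog_nonneg measureReal_nonneg measureReal_le_one

/-- A partition which is a function of another one has at most the same entropy. -/
lemma partitionEntropy_le_of_factor {α : Type*} [Fintype α] [IsFiniteMeasure μ] {ξ : X → α}
    {η : X → κ} (hη : Measurable η) (g : κ → α) (h : ∀ x, ξ x = g (η x)) :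
    partitionEntropy μ ξ ≤ partitionEntropy μ η := by
  classical
  unfold partitionEntropy
  rw [← Finset.sum_fiberwise (s := Finset.univ) (g := g)]
  refine Finset.sum_le_sum fun i _ => ?_
  have : μ.real (ξ ⁻¹' {i}) = ∑ k with g k = i, μ.real (η ⁻¹' {k}) := by
    rw [sum_real_preimage hη]
    congr 1
    ext x
    simp [h]
  rw [this]
  exact negMulLog_sum_le _ _ fun _ _ => measureReal_nonneg

lemma partitionEntropy_eq_of_factor [IsFiniteMeasure μ] {ξ : X → ι} {η : X → κ}
    (hξ : Measurable ξ) (hη : Measurable η) (g : κ → ι) (f : ι → κ) (h : ∀ x, ξ x = g (η x))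
    (h' : ∀ x, η x = f (ξ x)) : partitionEntropy μ ξ = partitionEntropy μ η :=
  (partitionEntropy_le_of_factor hη g h).antisymm (partitionEntropy_le_of_factor hξ f h')

lemma partitionEntropy_le_log_card [IsProbabilityMeasure μ] {ξ : X → ι} (hξ : Measurable ξ) :
    partitionEntropy μ ξ ≤ Real.log (Fintype.card ι) := by
  have h := sum_negMulLog_add_le Finset.univ (fun i => μ.real (ξ ⁻¹' {i})) (fun _ => 0)
    fun _ _ => measureReal_nonneg
  simpa [sum_real_fibre hξ, partitionEntropy] using h

/-- Strong subadditivity of Shannon entropy. -/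
lemma partitionEntropy_submodular [IsProbabilityMeasure μ] {ξ : X → ι} {η : X → κ} {ζ : X → τ}
    (hξ : Measurable ξ) (hη : Measurable η) (hζ : Measurable ζ) :
    partitionEntropy μ (fun x => (ξ x, η x, ζ x)) + partitionEntropy μ η ≤
      partitionEntropy μ (fun x => (ξ x, η x)) + partitionEntropy μ (fun x => (η x, ζ x)) := by
  set p : ι → κ → τ → ℝ := fun a b c => μ.real ((fun x => (ξ x, η x, ζ x)) ⁻¹' {(a, b, c)})
  set q : ι → κ → ℝ := fun a b => μ.real ((fun x => (ξ x, η x)) ⁻¹' {(a, b)}) with hq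
  set s : κ → τ → ℝ := fun b c => μ.real ((fun x => (η x, ζ x)) ⁻¹' {(b, c)}) with hs
  set r : κ → ℝ := fun b => μ.real (η ⁻¹' {b}) with hr
  have p0 : ∀ a b c, 0 ≤ p a b c := fun _ _ _ => measureReal_nonneg
  have q0 : ∀ a b, 0 ≤ q a b := fun _ _ => measureReal_nonneg
  have s0 : ∀ b c, 0 ≤ s b c := fun _ _ => measureReal_nonneg
  have r0 : ∀ b, 0 ≤ r b := fun _ => measureReal_nonneg
  have pq : ∀ a b, ∑ c, p a b c = q a b := by
    intro a b
    have h := sum_real_preimage (μ := μ) (hξ.prodMk (hη.prodMk hζ))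
      ({a} ×ˢ ({b} ×ˢ Finset.univ))
    simp only [Finset.sum_product, Finset.sum_singleton] at h
    refine h.trans ?_
    simp only [hq]
    congr 1
    ext x
    simp [eq_comm, and_comm]
  have ps : ∀ b c, ∑ a, p a b c = s b c := fun b c =>
    sum_real_pair_left hξ (hη.prodMk hζ) (b, c)
  have qr : ∀ b, ∑ a, q a b = r b := fun b => sum_real_pair_left hξ hη b
  have sr : ∀ b, ∑ c, s b c = r b := fun b => sum_real_pair_right hη hζ b
  have p_le_q : ∀ a b c, p a b c ≤ q a b := fun a b c => by
    rw [← pq]; exact Finset.single_le_sum (fun i _ => p0 a b i) (Finset.mem_univ c)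
  have p_le_s : ∀ a b c, p a b c ≤ s b c := fun a b c => by
    rw [← ps]; exact Finset.single_le_sum (fun i _ => p0 i b c) (Finset.mem_univ a)
  have s_le_r : ∀ b c, s b c ≤ r b := fun b c => by
    rw [← sr]; exact Finset.single_le_sum (fun i _ => s0 b i) (Finset.mem_univ c)
  have key : ∀ a b c, Real.negMulLog (p a b c) - p a b c * Real.log (r b)
      ≤ -(p a b c * Real.log (q a b)) - p a b c * Real.log (s b c)
        + (q a b * s b c / r b - p a b c) := by
    intro a b c
    rcases (p0 a b c).eq_or_lt with h0 | h0
    · simp only [← h0, Real.negMulLog_zero, zero_mul, sub_zero, neg_zero, zero_add]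
      exact div_nonneg (mul_nonneg (q0 _ _) (s0 _ _)) (r0 _)
    have hq' := h0.trans_le (p_le_q a b c)
    have hs' := h0.trans_le (p_le_s a b c)
    have hr' := hs'.trans_le (s_le_r b c)
    have h2 := Real.log_le_sub_one_of_pos (x := q a b * s b c / r b / p a b c) (by positivity)
    rw [Real.log_div (by positivity) h0.ne', Real.log_div (by positivity) hr'.ne',
      Real.log_mul hq'.ne' hs'.ne'] at h2
    have h3 := mul_le_mul_of_nonneg_left h2 h0.le
    have h4 : p a b c * (q a b * s b c / r b / p a b c - 1) = q a b * s b c / r b - p a b c := by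
      field_simp
    rw [h4] at h3
    simp only [Real.negMulLog]
    linarith
  have hsum := Finset.sum_le_sum fun a (_ : a ∈ Finset.univ) =>
    Finset.sum_le_sum fun b (_ : b ∈ Finset.univ) =>
      Finset.sum_le_sum fun c (_ : c ∈ Finset.univ) => key a b c
  simp only [Finset.sum_add_distrib, Finset.sum_sub_distrib, Finset.sum_neg_distrib] at hsum
  have e1 : partitionEntropy μ (fun x => (ξ x, η x, ζ x)) =
      ∑ a, ∑ b, ∑ c, Real.negMulLog (p a b c) := by
    simp only [partitionEntropy, Fintype.sum_prod_type]; rfl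
  have e2 : partitionEntropy μ (fun x => (ξ x, η x)) =
      -∑ a, ∑ b, ∑ c, p a b c * Real.log (q a b) := by
    simp only [partitionEntropy, Fintype.sum_prod_type, ← Finset.sum_mul, pq, Real.negMulLog,
      neg_mul, Finset.sum_neg_distrib]
    rfl
  have e3 : partitionEntropy μ (fun x => (η x, ζ x)) =
      -∑ a, ∑ b, ∑ c, p a b c * Real.log (s b c) := by
    rw [Finset.sum_comm]
    have : ∀ b, ∑ a, ∑ c, p a b c * Real.log (s b c) = ∑ c, s b c * Real.log (s b c) := by
      intro b
      rw [Finset.sum_comm]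
      simp only [← Finset.sum_mul, ps]
    simp only [this, partitionEntropy, Fintype.sum_prod_type, Real.negMulLog,
      neg_mul, Finset.sum_neg_distrib]
    rfl
  have e4 : partitionEntropy μ η = -∑ a, ∑ b, ∑ c, p a b c * Real.log (r b) := by
    rw [Finset.sum_comm]
    simp only [← Finset.sum_mul, pq, qr, partitionEntropy, Real.negMulLog,
      neg_mul, Finset.sum_neg_distrib]
    rfl
  have e5 : ∑ a, ∑ b, ∑ c, p a b c = 1 := by
    rw [Finset.sum_comm]
    simp only [pq, qr]
    exact sum_real_fibre hη
  have e6 : ∑ a, ∑ b, ∑ c, q a b * s b c / r b = 1 := by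
    rw [Finset.sum_comm]
    have : ∀ b, ∑ a, ∑ c, q a b * s b c / r b = r b := by
      intro b
      simp only [← Finset.sum_div, ← Finset.mul_sum, sr, ← Finset.sum_mul, qr]
      exact mul_self_div_self _
    simp only [this]
    exact sum_real_fibre hη
  rw [e1, e2, e3, e4]
  rw [e5, e6] at hsum
  linarith

/-- Conditioning on a finer partition decreases conditional entropy. -/
lemma condEntropy_le_of_factor [IsProbabilityMeasure μ] {ξ : X → ι} {η : X → κ} {ζ : X → τ}
    (hξ : Measurable ξ) (hη : Measurable η) (hζ : Measurable ζ) (g : τ → κ)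
    (h : ∀ x, η x = g (ζ x)) : condEntropy μ ξ ζ ≤ condEntropy μ ξ η := by
  have h1 := partitionEntropy_submodular (μ := μ) hξ hη hζ
  have h2 : partitionEntropy μ (fun x => (ξ x, η x, ζ x)) =
      partitionEntropy μ (fun x => (ξ x, ζ x)) :=
    partitionEntropy_eq_of_factor (hξ.prodMk (hη.prodMk hζ)) (hξ.prodMk hζ)
      (fun y => (y.1, g y.2, y.2)) (fun y => (y.1, y.2.2)) (by simp [h]) (by simp)
  have h3 : partitionEntropy μ (fun x => (η x, ζ x)) = partitionEntropy μ ζ :=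
    partitionEntropy_eq_of_factor (hη.prodMk hζ) hζ (fun y => (g y, y)) Prod.snd
      (by simp [h]) (by simp)
  unfold condEntropy
  linarith

/-- Subadditivity of Shannon entropy. -/
lemma partitionEntropy_pair_le [IsProbabilityMeasure μ] {ξ : X → ι} {η : X → κ}
    (hξ : Measurable ξ) (hη : Measurable η) :
    partitionEntropy μ (fun x => (ξ x, η x)) ≤ partitionEntropy μ ξ + partitionEntropy μ η := by
  have hu : Measurable fun _ : X => () := measurable_const
  have h1 := partitionEntropy_submodular (μ := μ) hξ hu hη
  have h2 : partitionEntropy μ (fun x => (ξ x, (), η x)) =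
      partitionEntropy μ (fun x => (ξ x, η x)) :=
    partitionEntropy_eq_of_factor (hξ.prodMk (hu.prodMk hη)) (hξ.prodMk hη)
      (fun y => (y.1, (), y.2)) (fun y => (y.1, y.2.2)) (by simp) (by simp)
  have h3 : partitionEntropy μ (fun x => ((), η x)) = partitionEntropy μ η :=
    partitionEntropy_eq_of_factor (hu.prodMk hη) hη (fun y => ((), y)) Prod.snd
      (by simp) (by simp)
  have h4 : partitionEntropy μ (fun x => (ξ x, ())) = partitionEntropy μ ξ :=
    partitionEntropy_eq_of_factor (hξ.prodMk hu) hξ (fun y => (y, ())) Prod.fst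
      (by simp) (by simp)
  have h5 := partitionEntropy_nonneg (μ := μ) fun _ : X => ()
  linarith

/-- If on each cell of `η` the partition `ξ` takes values in the finite set `S`, its conditional
entropy is at most the average of `log #S`. -/
lemma condEntropy_le_sum_log_card [IsFiniteMeasure μ] {ξ : X → ι} {η : X → κ} (hξ : Measurable ξ)
    (hη : Measurable η) (S : κ → Finset ι) (hS : ∀ x, ξ x ∈ S (η x)) :
    condEntropy μ ξ η ≤ ∑ d, μ.real (η ⁻¹' {d}) * Real.log (S d).card := by
  unfold condEntropy partitionEntropy
  rw [Fintype.sum_prod_type_right, ← Finset.sum_sub_distrib]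
  refine Finset.sum_le_sum fun d _ => ?_
  have h0 : ∀ c ∉ S d, μ.real ((fun x => (ξ x, η x)) ⁻¹' {(c, d)}) = 0 := by
    intro c hc
    have : (fun x => (ξ x, η x)) ⁻¹' {(c, d)} = ∅ := by
      ext x
      simp only [mem_preimage, mem_singleton_iff, Prod.mk.injEq, mem_empty_iff_false, iff_false]
      rintro ⟨rfl, rfl⟩
      exact hc (hS x)
    simp [this]
  have h1 := sum_negMulLog_add_le (S d) (fun c => μ.real ((fun x => (ξ x, η x)) ⁻¹' {(c, d)}))
    (fun _ => 0) fun _ _ => measureReal_nonneg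
  rw [← sum_real_pair_left hξ hη d, sub_le_iff_le_add']
  rw [← Finset.sum_subset (Finset.subset_univ (S d)) fun c _ hc => h0 c hc,
    ← Finset.sum_subset (Finset.subset_univ (S d)) fun c _ hc => by simp [h0 c hc]]
  simpa using h1

/-- Partitions which agree outside a small set have small relative entropy. -/
lemma exists_condEntropy_le_of_measure_ne_lt (ι : Type*) [Fintype ι] [MeasurableSpace ι]
    [MeasurableSingletonClass ι] {ε : ℝ} (hε : 0 < ε) :
    ∃ δ > 0, ∀ {X : Type*} [MeasurableSpace X] (μ : Measure X) [IsProbabilityMeasure μ]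
      (ξ ξ' : X → ι), Measurable ξ → Measurable ξ' → μ.real {x | ξ x ≠ ξ' x} < δ →
      condEntropy μ ξ ξ' ≤ ε := by
  classical
  set K : ℝ := (Fintype.card ι : ℝ) * Fintype.card ι + 1 with hK
  have hK0 : 0 < K := by positivity
  have hc := Real.continuous_negMulLog.tendsto 0
  rw [Real.negMulLog_zero, Metric.tendsto_nhds_nhds] at hc
  obtain ⟨δ, hδ, hc⟩ := hc (ε / K) (by positivity)
  refine ⟨min δ (ε / K), by positivity, ?_⟩
  intro X _ μ _ ξ ξ' hξ hξ' hμ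
  set p : ι → ι → ℝ := fun c d => μ.real ((fun x => (ξ x, ξ' x)) ⁻¹' {(c, d)}) with hp
  have p0 : ∀ c d, 0 ≤ p c d := fun _ _ => measureReal_nonneg
  set P : ι → ℝ := fun d => μ.real (ξ' ⁻¹' {d}) with hP
  have hpP : ∀ d, ∑ c, p c d = P d := sum_real_pair_left hξ hξ'
  have p_le : ∀ c d, p c d ≤ P d := fun c d => by
    rw [← hpP]; exact Finset.single_le_sum (fun i _ => p0 i d) (Finset.mem_univ c)
  have hP1 : ∀ d, P d ≤ 1 := fun d => measureReal_le_one
  have hoff : ∀ c d, c ≠ d → p c d < δ ∧ p c d < ε / K := by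
    intro c d hcd
    have : p c d ≤ μ.real {x | ξ x ≠ ξ' x} := by
      refine measureReal_mono ?_
      intro x hx
      simp only [mem_preimage, mem_singleton_iff, Prod.mk.injEq] at hx
      simpa [hx.1, hx.2] using hcd
    exact ⟨(this.trans_lt hμ).trans_le (min_le_left _ _),
      (this.trans_lt hμ).trans_le (min_le_right _ _)⟩
  have hdiag : ∑ d, (P d - p d d) ≤ ε / K := by
    have e : μ.real {x | ξ x ≠ ξ' x} = 1 - ∑ d, p d d := by
      have h1 := sum_real_preimage (μ := μ) (hξ.prodMk hξ') Finset.univ.diag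
      rw [Finset.sum_diag] at h1
      have h2 : {x | ξ x ≠ ξ' x} =
          ((fun x => (ξ x, ξ' x)) ⁻¹' ((Finset.univ : Finset ι).diag : Set (ι × ι)))ᶜ := by
        ext x; simp
      rw [h2, probReal_compl_eq_one_sub, ← h1]
      exact (hξ.prodMk hξ') (Finset.measurableSet _)
    rw [Finset.sum_sub_distrib, sum_real_fibre hξ', ← e]
    exact hμ.le.trans (min_le_right _ _)
  have hterm : ∀ c d, Real.negMulLog (p c d) + p c d * Real.log (P d) ≤
      ε / K + if c = d then P d - p d d - ε / K else 0 := by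
    intro c d
    split_ifs with hcd
    · subst hcd
      rcases (p0 c c).eq_or_lt with h0 | h0
      · simp only [← h0, Real.negMulLog_zero, zero_mul]
        have := (p0 c c).trans (p_le c c)
        linarith
      have hP0 := h0.trans_le (p_le c c)
      have h2 := Real.log_le_sub_one_of_pos (x := P c / p c c) (by positivity)
      rw [Real.log_div hP0.ne' h0.ne'] at h2
      have h3 := mul_le_mul_of_nonneg_left h2 h0.le
      have h4 : p c c * (P c / p c c - 1) = P c - p c c := by field_simp
      rw [h4] at h3
      simp only [Real.negMulLog]
      linarith
    · have h1 := hc (x := p c d) (by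
        rw [Real.dist_eq, sub_zero, abs_of_nonneg (p0 c d)]; exact (hoff c d hcd).1)
      rw [Real.dist_eq, sub_zero] at h1
      have h2 : p c d * Real.log (P d) ≤ 0 :=
        mul_nonpos_of_nonneg_of_nonpos (p0 c d)
          (Real.log_nonpos ((p0 c d).trans (p_le c d)) (hP1 d))
      have := le_abs_self (Real.negMulLog (p c d))
      linarith
  have hsum : condEntropy μ ξ ξ' =
      ∑ d, ∑ c, (Real.negMulLog (p c d) + p c d * Real.log (P d)) := by
    simp only [condEntropy, partitionEntropy, Fintype.sum_prod_type_right, Finset.sum_add_distrib,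
      ← Finset.sum_mul, hpP, Real.negMulLog, neg_mul, Finset.sum_neg_distrib, sub_neg_eq_add]
    rfl
  rw [hsum]
  calc _ ≤ ∑ d, ∑ c, (ε / K + if c = d then P d - p d d - ε / K else 0) :=
        Finset.sum_le_sum fun d _ => Finset.sum_le_sum fun c _ => hterm c d
    _ = (Fintype.card ι * Fintype.card ι) * (ε / K) + ∑ d, (P d - p d d)
          - Fintype.card ι * (ε / K) := by
        simp [Finset.sum_add_distrib, mul_assoc]
        ring
    _ ≤ (Fintype.card ι * Fintype.card ι) * (ε / K) + ε / K := by
        have : 0 ≤ (Fintype.card ι : ℝ) * (ε / K) := by positivity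
        linarith
    _ = K * (ε / K) := by rw [hK]; ring
    _ = ε := by field_simp

end Entropy

/-! ### Dynamical entropy of partitions -/

section Rate

variable {X : Type*} [MeasurableSpace X] {ι κ : Type*}
  [Fintype ι] [MeasurableSpace ι] [MeasurableSingletonClass ι]
  [Fintype κ] [MeasurableSpace κ] [MeasurableSingletonClass κ]
  {μ : Measure X} {T : X → X}

lemma measurable_refinement {X ι : Type*} [MeasurableSpace X] [MeasurableSpace ι] {T : X → X}
    {ξ : X → ι} (hT : Measurable T) (hξ : Measurable ξ) (n : ℕ) :
    Measurable (refinement T ξ n) :=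
  measurable_pi_lambda _ fun i => hξ.comp (hT.iterate i)

lemma partitionEntropy_comp_measurePreserving {α : Type*} [Fintype α] [MeasurableSpace α]
    [MeasurableSingletonClass α] {Y : Type*} [MeasurableSpace Y] {ν : Measure Y} {S : X → Y}
    (hS : MeasurePreserving S μ ν) {ξ : Y → α} (hξ : Measurable ξ) :
    partitionEntropy μ (ξ ∘ S) = partitionEntropy ν ξ := by
  unfold partitionEntropy
  refine Finset.sum_congr rfl fun i _ => ?_
  rw [preimage_comp, hS.measureReal_preimage (hξ (measurableSet_singleton i)).nullMeasurableSet]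

lemma condEntropy_comp_measurePreserving {Y : Type*} [MeasurableSpace Y] {ν : Measure Y} {S : X → Y}
    (hS : MeasurePreserving S μ ν) {ξ : Y → ι} {η : Y → κ} (hξ : Measurable ξ)
    (hη : Measurable η) : condEntropy μ (ξ ∘ S) (η ∘ S) = condEntropy ν ξ η := by
  unfold condEntropy
  rw [← partitionEntropy_comp_measurePreserving hS (hξ.prodMk hη),
    ← partitionEntropy_comp_measurePreserving hS hη]
  rfl

lemma refinement_succ_apply {X ι : Type*} (T : X → X) (ξ : X → ι) (n : ℕ) (x : X) :
    refinement T ξ (n + 1) x = Fin.snoc (α := fun _ => ι) (refinement T ξ n x) (ξ (T^[n] x)) := by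
  funext i
  refine Fin.lastCases ?_ (fun j => ?_) i
  · simp [refinement]
  · simp [refinement]

/-- `H(ξⁿ) ≤ H(ηⁿ) + n H(ξ | η)`: passing from one partition to another changes the entropy of the
`n`-th refinements by at most `n` times the conditional entropy. -/
lemma partitionEntropy_refinement_le_add [IsProbabilityMeasure μ] (hT : MeasurePreserving T μ μ)
    {ξ : X → ι} {η : X → κ} (hξ : Measurable ξ) (hη : Measurable η) (n : ℕ) :
    partitionEntropy μ (refinement T ξ n) ≤
      partitionEntropy μ (refinement T η n) + n * condEntropy μ ξ η := by
  suffices h : condEntropy μ (refinement T ξ n) (refinement T η n) ≤ n * condEntropy μ ξ η by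
    have h1 : partitionEntropy μ (refinement T ξ n) ≤
        partitionEntropy μ (fun x => (refinement T ξ n x, refinement T η n x)) :=
      partitionEntropy_le_of_factor ((measurable_refinement hT.measurable hξ n).prodMk
        (measurable_refinement hT.measurable hη n)) Prod.fst fun _ => rfl
    unfold condEntropy at h ⊢
    linarith
  have mξ := fun n => measurable_refinement hT.measurable hξ n
  have mη := fun n => measurable_refinement hT.measurable hη n
  induction n with
  | zero =>
    have : partitionEntropy μ (fun x => (refinement T ξ 0 x, refinement T η 0 x)) ≤
        partitionEntropy μ (refinement T η 0) :=
      partitionEntropy_le_of_factor (mη 0) (fun y => (Fin.elim0, y))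
        fun x => by ext i; exact i.elim0; rfl
    simpa [condEntropy] using this
  | succ n ih =>
    have mTn := hT.iterate n
    have mξn : Measurable (ξ ∘ T^[n]) := hξ.comp mTn.measurable
    have mηn : Measurable (η ∘ T^[n]) := hη.comp mTn.measurable
    -- chain rule: split off the last coordinate of the refinement of `ξ`
    have e : partitionEntropy μ (fun x => (refinement T ξ (n + 1) x, refinement T η (n + 1) x)) =
        partitionEntropy μ (fun x => ((ξ ∘ T^[n]) x, (refinement T ξ n x,
          refinement T η (n + 1) x))) :=
      partitionEntropy_eq_of_factor ((mξ _).prodMk (mη _)) (mξn.prodMk ((mξ _).prodMk (mη _)))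
        (fun y => (Fin.snoc (α := fun _ => ι) y.2.1 y.1, y.2.2))
        (fun y => (y.1 (Fin.last n), (Fin.init y.1, y.2)))
        (fun x => by simp [refinement_succ_apply])
        (fun x => by simp [refinement_succ_apply])
    have h1 : condEntropy μ (ξ ∘ T^[n]) (fun x => (refinement T ξ n x, refinement T η (n + 1) x)) ≤
        condEntropy μ (ξ ∘ T^[n]) (η ∘ T^[n]) :=
      condEntropy_le_of_factor mξn mηn ((mξ _).prodMk (mη _)) (fun y => y.2 (Fin.last n))
        (fun x => by simp [refinement])
    have h2 : condEntropy μ (refinement T ξ n) (refinement T η (n + 1)) ≤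
        condEntropy μ (refinement T ξ n) (refinement T η n) :=
      condEntropy_le_of_factor (mξ _) (mη _) (mη _) (fun y => Fin.init y)
        (fun x => by simp [refinement_succ_apply])
    rw [condEntropy_comp_measurePreserving mTn hξ hη] at h1
    have h3 : condEntropy μ (refinement T ξ (n + 1)) (refinement T η (n + 1)) =
        condEntropy μ (ξ ∘ T^[n]) (fun x => (refinement T ξ n x, refinement T η (n + 1) x)) +
        condEntropy μ (refinement T ξ n) (refinement T η (n + 1)) := by
      unfold condEntropy
      rw [e]
      ring
    push_cast
    linarith

lemma partitionEntropy_refinement_mono [IsFiniteMeasure μ] (hT : Measurable T) {ξ : X → ι}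
    (hξ : Measurable ξ) {m n : ℕ} (h : m ≤ n) :
    partitionEntropy μ (refinement T ξ m) ≤ partitionEntropy μ (refinement T ξ n) :=
  partitionEntropy_le_of_factor (measurable_refinement hT hξ n)
    (fun y i => y (Fin.castLE h i)) fun _ => rfl

/-- The `(n m)`-th refinement under `T` is a function of the `n`-th refinement under `T^m` of the
`m`-th refinement. -/
lemma partitionEntropy_refinement_mul_le [IsFiniteMeasure μ] (hT : Measurable T) {ξ : X → ι}
    (hξ : Measurable ξ) {m : ℕ} (hm : 0 < m) (n : ℕ) :
    partitionEntropy μ (refinement T ξ (n * m)) ≤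
      partitionEntropy μ (refinement (T^[m]) (refinement T ξ m) n) := by
  refine partitionEntropy_le_of_factor
    (measurable_refinement (hT.iterate m) (measurable_refinement hT hξ m) n)
    (fun y i => y ⟨i / m, Nat.div_lt_of_lt_mul (i.2.trans_eq (mul_comm n m))⟩
      ⟨i % m, Nat.mod_lt _ hm⟩) fun x => ?_
  funext i
  simp only [refinement]
  rw [← Function.iterate_mul, ← Function.iterate_add_apply, Nat.mod_add_div]

lemma eventually_partitionEntropy_le_of_rate_lt {α : Type*} [Fintype α] {ξ : X → α} {c : ℝ}
    (h : partitionEntropyRate μ T ξ < (c : EReal)) :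
    ∀ᶠ n : ℕ in atTop, partitionEntropy μ (refinement T ξ n) ≤ n * c := by
  filter_upwards [eventually_lt_of_limsup_lt h, eventually_gt_atTop 0] with n hn h0
  rw [EReal.coe_lt_coe_iff, div_lt_iff₀ (by exact_mod_cast h0)] at hn
  linarith

/-- A bound for the entropies of the refinements along the multiples of `m` bounds the rate. -/
lemma partitionEntropyRate_le [IsFiniteMeasure μ] (hT : Measurable T) {ξ : X → ι}
    (hξ : Measurable ξ) {m : ℕ} (hm : 0 < m) {a b : ℝ}
    (h : ∀ᶠ n : ℕ in atTop, partitionEntropy μ (refinement T ξ (n * m)) ≤ n * m * a + b) :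
    partitionEntropyRate μ T ξ ≤ (a : EReal) := by
  have hdiv : Tendsto (fun n : ℕ => n / m + 1) atTop atTop :=
    (tendsto_add_atTop_nat 1).comp (Nat.tendsto_div_const_atTop hm.ne')
  set C : ℝ := m * |a| + b
  have hev : ∀ᶠ n : ℕ in atTop,
      ((partitionEntropy μ (refinement T ξ n) / (n : ℝ) : ℝ) : EReal)
        ≤ ((a + C / n : ℝ) : EReal) := by
    filter_upwards [hdiv.eventually h, eventually_gt_atTop 0] with n hn h0
    have h0' : (0 : ℝ) < n := by exact_mod_cast h0
    have hle : n ≤ (n / m + 1) * m := by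
      have := Nat.lt_div_mul_add (a := n) hm
      nlinarith
    have hle' : (n / m + 1) * m ≤ n + m := by
      have := Nat.div_mul_le_self n m
      nlinarith
    have h1 := (partitionEntropy_refinement_mono hT hξ hle).trans hn
    have h2 : (n : ℝ) ≤ ((n / m + 1 : ℕ) : ℝ) * m := by exact_mod_cast hle
    have h3 : ((n / m + 1 : ℕ) : ℝ) * m ≤ n + m := by exact_mod_cast hle'
    have h4 : ((n / m + 1 : ℕ) : ℝ) * m * a ≤ n * a + m * |a| := by
      rcases le_total 0 a with h | h
      · rw [abs_of_nonneg h]; nlinarith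
      · have : 0 ≤ (m : ℝ) * |a| := by positivity
        nlinarith
    rw [EReal.coe_le_coe_iff, div_le_iff₀ h0', add_mul, div_mul_cancel₀ _ h0'.ne']
    linarith
  have hlim : Tendsto (fun n : ℕ => ((a + C / n : ℝ) : EReal)) atTop (𝓝 (a : EReal)) := by
    rw [EReal.tendsto_coe]
    simpa using tendsto_const_nhds.add (tendsto_const_div_atTop_nhds_zero_nat C)
  unfold partitionEntropyRate
  rw [← hlim.limsup_eq]
  exact limsup_le_limsup hev

lemma partitionEntropyRate_le_of_eventually_le [IsFiniteMeasure μ] (hT : Measurable T) {ξ : X → ι}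
    (hξ : Measurable ξ) {a b : ℝ}
    (h : ∀ᶠ n : ℕ in atTop, partitionEntropy μ (refinement T ξ n) ≤ n * a + b) :
    partitionEntropyRate μ T ξ ≤ (a : EReal) :=
  partitionEntropyRate_le hT hξ one_pos <| h.mono fun n hn => by
    rw [mul_one n, Nat.cast_one, mul_one]
    exact hn

lemma partitionEntropyRate_nonneg {α : Type*} [Fintype α] [IsProbabilityMeasure μ] {ξ : X → α} :
    0 ≤ partitionEntropyRate μ T ξ := by
  refine le_limsup_of_frequently_le (Frequently.of_forall fun n => ?_)
  exact_mod_cast div_nonneg (partitionEntropy_nonneg _) n.cast_nonneg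

lemma entropy_nonneg [IsProbabilityMeasure μ] : 0 ≤ entropy μ T :=
  (partitionEntropyRate_nonneg (ξ := fun _ : X => (0 : Fin 1))).trans
    (le_iSup_of_le 1 (le_iSup_of_le _ (le_iSup_of_le measurable_const le_rfl)))

/-- Partitions indexed by an arbitrary finite type also bound the entropy from below. -/
lemma partitionEntropyRate_le_entropy [IsFiniteMeasure μ] (hT : Measurable T) {ξ : X → ι}
    (hξ : Measurable ξ) : partitionEntropyRate μ T ξ ≤ entropy μ T := by
  let e := Fintype.equivFin ι
  have hm : Measurable (e ∘ ξ) := (Measurable.of_discrete (f := e)).comp hξ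
  have h : partitionEntropyRate μ T ξ = partitionEntropyRate μ T (e ∘ ξ) := by
    unfold partitionEntropyRate
    congr 1
    funext n
    rw [partitionEntropy_eq_of_factor (measurable_refinement hT hξ n)
      (measurable_refinement hT hm n) (fun y i => e.symm (y i)) (fun y i => e (y i))
      (fun x => by funext i; simp [refinement]) (fun x => by funext i; simp [refinement])]
  rw [h]
  exact le_iSup_of_le _ (le_iSup_of_le _ (le_iSup_of_le hm le_rfl))

end Rate

/-! ### Partitions of compact metric spaces -/

/-- A finite measurable cover has a measurable choice function. -/
lemma exists_measurable_choice {X ι : Type*} [MeasurableSpace X] [Fintype ι] [MeasurableSpace ι]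
    [MeasurableSingletonClass ι] (U : ι → Set X) (hU : ∀ i, MeasurableSet (U i))
    (hcov : ∀ x, ∃ i, x ∈ U i) : ∃ g : X → ι, Measurable g ∧ ∀ x, x ∈ U (g x) := by
  classical
  let e := Fintype.equivFin ι
  rcases isEmpty_or_nonempty X with hX | ⟨⟨x₀⟩⟩
  · exact ⟨fun x => hX.elim x, measurable_of_empty _, fun x => hX.elim x⟩
  obtain ⟨i₀, -⟩ := hcov x₀
  let dec : ℕ → ι := fun n => if h : n < Fintype.card ι then e.symm ⟨n, h⟩ else i₀
  have hcov' : ∀ x, ∃ n, n < Fintype.card ι ∧ x ∈ U (dec n) := fun x => by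
    obtain ⟨i, hi⟩ := hcov x
    exact ⟨e i, (e i).2, by simpa [dec] using hi⟩
  have hmeas : ∀ n, MeasurableSet {x | n < Fintype.card ι ∧ x ∈ U (dec n)} := fun n =>
    (MeasurableSet.const _).inter (hU _)
  refine ⟨fun x => dec (Nat.find (hcov' x)),
    (Measurable.of_discrete (f := dec)).comp (measurable_find hcov' hmeas),
    fun x => (Nat.find_spec (hcov' x)).2⟩

section Metric

variable {X : Type*} [MetricSpace X] [CompactSpace X] [MeasurableSpace X] [BorelSpace X]

/-- A compact metric space has finite measurable partitions with cells of small diameter. -/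
lemma exists_partition_dist_lt {δ : ℝ} (hδ : 0 < δ) :
    ∃ (k : ℕ) (α : X → Fin k), Measurable α ∧ ∀ x y, α x = α y → dist x y < δ := by
  obtain ⟨t, -, htf, ht⟩ := Metric.finite_approx_of_totallyBounded
    (isCompact_univ (X := X)).totallyBounded (δ / 2) (half_pos hδ)
  classical
  have : Fintype t := htf.fintype
  let e := Fintype.equivFin t
  obtain ⟨g, hg, hgU⟩ := exists_measurable_choice (X := X)
    (fun i : Fin (Fintype.card t) => Metric.ball ((e.symm i : t) : X) (δ / 2))
    (fun _ => Metric.isOpen_ball.measurableSet) (fun x => by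
      have := ht (mem_univ x)
      simp only [mem_iUnion] at this
      obtain ⟨y, hy, hxy⟩ := this
      exact ⟨e ⟨y, hy⟩, by simpa using hxy⟩)
  refine ⟨_, g, hg, fun x y hxy => ?_⟩
  have h1 := hgU x
  have h2 := hgU y
  rw [← hxy] at h2
  rw [Metric.mem_ball] at h1 h2
  have := dist_triangle_right x y ((e.symm (g x) : t) : X)
  linarith

/-- Misiurewicz' construction. Every finite measurable partition `ξ` can be altered on a set
of small measure (labelled `none`) so that the remaining cells are disjoint compact sets; every set
of small diameter then meets at most one of them. -/
lemma exists_compact_refinement {ι : Type*} [Fintype ι] [MeasurableSpace ι]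
    [MeasurableSingletonClass ι] (μ : Measure X) [IsProbabilityMeasure μ] {ξ : X → ι}
    (hξ : Measurable ξ) {c : ℝ} (hc : 0 < c) :
    ∃ (η : X → Option ι) (δ : ℝ) (j : X → ι), (∀ o, MeasurableSet (η ⁻¹' {o})) ∧ 0 < δ ∧
      (∀ y z, dist y z < δ → η y = none ∨ η y = some (j z)) ∧
      (∀ y i, η y = some i → ξ y = i) ∧ μ.real {y | η y = none} < c := by
  classical
  have hA : ∀ i, MeasurableSet (ξ ⁻¹' {i}) := fun i => hξ (measurableSet_singleton i)
  set c' : ℝ := c / (Fintype.card ι + 1) with hc'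
  have hc0 : 0 < c' := by positivity
  have hK : ∀ i, ∃ K ⊆ ξ ⁻¹' {i}, IsClosed K ∧ μ (ξ ⁻¹' {i} \ K) < ENNReal.ofReal c' := fun i =>
    (hA i).exists_isClosed_sdiff_lt (measure_ne_top _ _) (by simpa using hc0)
  choose K hKsub hKcl hKμ using hK
  have hKi : ∀ {y i}, y ∈ K i → ξ y = i := fun h => hKsub _ h
  obtain ⟨δ, hδ, hL⟩ := lebesgue_number_lemma_of_metric (isCompact_univ (X := X))
    (c := fun i : ι => (⋃ j ∈ ({i}ᶜ : Set ι), K j)ᶜ)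
    (fun i => (Set.toFinite _).isClosed_biUnion (fun j _ => hKcl j) |>.isOpen_compl)
    (fun y _ => by
      simp only [mem_iUnion, mem_compl_iff, mem_singleton_iff]
      refine ⟨ξ y, ?_⟩
      rintro ⟨j, hj, hy⟩
      exact hj (hKi hy).symm)
  choose j hj using fun z : X => hL z (mem_univ z)
  set η : X → Option ι := fun y => if y ∈ K (ξ y) then some (ξ y) else none with hη
  have hsome : ∀ y i, η y = some i ↔ y ∈ K i := by
    intro y i
    by_cases h : y ∈ K (ξ y)
    · simp only [hη, h, if_true, Option.some.injEq]
      exact ⟨fun e => e ▸ h, fun h' => hKi h'⟩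
    · simp only [hη, h, if_false, reduceCtorEq, false_iff]
      intro h'
      exact h (by rwa [hKi h'])
  have hmS : ∀ i, η ⁻¹' {some i} = K i := fun i => by ext y; exact hsome y i
  have hnone : η ⁻¹' {none} = ⋃ i, (ξ ⁻¹' {i} \ K i) := by
    ext y
    simp only [mem_preimage, mem_singleton_iff, mem_iUnion, Set.mem_sdiff]
    simp [hη]
  refine ⟨η, δ, j, ?_, hδ, ?_, ?_, ?_⟩
  · rintro (_ | i)
    · rw [hnone]
      exact MeasurableSet.iUnion fun i => (hA i).diff (hKcl i).measurableSet
    · rw [hmS]; exact (hKcl i).measurableSet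
  · intro y z hyz
    rcases h : η y with _ | i
    · exact Or.inl rfl
    · refine Or.inr ?_
      have hy : y ∈ K i := (hsome y i).1 h
      have := hj z (Metric.mem_ball.2 hyz)
      simp only [mem_compl_iff, mem_iUnion, not_exists, mem_singleton_iff] at this
      congr
      by_contra hne
      exact this i hne hy
  · intro y i h
    exact hKi ((hsome y i).1 h)
  · have h1 : {y | η y = none} = ⋃ i, (ξ ⁻¹' {i} \ K i) := hnone
    rw [h1]
    calc μ.real (⋃ i, (ξ ⁻¹' {i} \ K i)) ≤ ∑ i, μ.real (ξ ⁻¹' {i} \ K i) :=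
          measureReal_iUnion_fintype_le _
      _ ≤ ∑ _i : ι, c' := Finset.sum_le_sum fun i _ =>
          (ENNReal.toReal_mono ENNReal.ofReal_ne_top (hKμ i).le).trans_eq
            (ENNReal.toReal_ofReal hc0.le)
      _ = Fintype.card ι * c' := by simp
      _ < c := by
          rw [hc', mul_div_assoc', div_lt_iff₀ (by positivity)]
          nlinarith

/-- The version of `exists_compact_refinement` in which the loss is measured by entropy. -/
lemma exists_compact_refinement_condEntropy {ι : Type*} [Fintype ι] [MeasurableSpace ι]
    [MeasurableSingletonClass ι] [Nonempty ι] [MeasurableSpace (Option ι)]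
    [MeasurableSingletonClass (Option ι)] (μ : Measure X) [IsProbabilityMeasure μ] {ξ : X → ι}
    (hξ : Measurable ξ) :
    ∃ (η : X → Option ι) (δ : ℝ) (j : X → ι), Measurable η ∧ 0 < δ ∧
      (∀ y z, dist y z < δ → η y = none ∨ η y = some (j z)) ∧ condEntropy μ ξ η ≤ 1 := by
  obtain ⟨c, hc, hF⟩ := exists_condEntropy_le_of_measure_ne_lt ι one_pos
  obtain ⟨η, δ, j, hη, hδ, h1, h2, h3⟩ := exists_compact_refinement μ hξ hc
  have hηm : Measurable η := measurable_to_countable' hη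
  refine ⟨η, δ, j, hηm, hδ, h1, ?_⟩
  set g : Option ι → ι := fun o => o.getD (Classical.arbitrary ι)
  have hgm : Measurable (g ∘ η) := (Measurable.of_discrete (f := g)).comp hηm
  refine (condEntropy_le_of_factor hξ hgm hηm g fun _ => rfl).trans (hF μ ξ _ hξ hgm ?_)
  refine (measureReal_mono ?_).trans_lt h3
  intro y hy
  rcases h : η y with _ | i
  · exact h
  · exact absurd (by simp [g, h, h2 y i h]) hy

/-- Partitions of small diameter determine any given partition up to small entropy. -/
lemma exists_condEntropy_le_of_dist_lt {ι : Type*} [Fintype ι] [MeasurableSpace ι]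
    [MeasurableSingletonClass ι] (μ : Measure X) [IsProbabilityMeasure μ] {ξ : X → ι}
    (hξ : Measurable ξ) {ε : ℝ} (hε : 0 < ε) :
    ∃ δ > 0, ∀ {κ : Type} [Fintype κ] [MeasurableSpace κ] [MeasurableSingletonClass κ] (α : X → κ),
      Measurable α → (∀ x y, α x = α y → dist x y < δ) → condEntropy μ ξ α ≤ ε := by
  classical
  obtain ⟨c, hc, hF⟩ := exists_condEntropy_le_of_measure_ne_lt ι hε
  obtain ⟨η, δ, j, -, hδ, h1, h2, h3⟩ := exists_compact_refinement μ hξ hc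
  refine ⟨δ, hδ, fun {κ} _ _ _ α hα hd => ?_⟩
  obtain ⟨x₀⟩ : Nonempty X := nonempty_of_isProbabilityMeasure μ
  set g : κ → ι := fun d => if h : ∃ x, α x = d then j h.choose else j x₀ with hg
  have hgm : Measurable (g ∘ α) := (Measurable.of_discrete (f := g)).comp hα
  refine (condEntropy_le_of_factor hξ hgm hα g fun _ => rfl).trans (hF μ ξ _ hξ hgm ?_)
  refine (measureReal_mono ?_).trans_lt h3
  intro y hy
  by_contra hne
  have hex : ∃ x, α x = α y := ⟨y, rfl⟩
  have h4 := (h1 y hex.choose (hd _ _ hex.choose_spec.symm)).resolve_left hne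
  refine hy ?_
  rw [h2 y _ h4]
  simp [hg, hex]

end Metric

/-! ### Uniform estimates for flows on compact spaces -/

section FlowEstimates

variable {X : Type*} [MetricSpace X] [CompactSpace X] (F : Flow ℝ X)

lemma flow_one_iterate {X : Type*} [TopologicalSpace X] (F : Flow ℝ X) (n : ℕ) (x : X) :
    (F 1)^[n] x = F n x := by
  induction n with
  | zero => simp
  | succ n ih => rw [Function.iterate_succ_apply', ih, ← F.map_add]; congr 1; push_cast; ring

lemma flow_neg_apply {X : Type*} [TopologicalSpace X] (F : Flow ℝ X) (t : ℝ) (x : X) :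
    F (-t) (F t x) = x := by
  rw [← F.map_add, neg_add_cancel, F.map_zero_apply]

lemma exists_dist_flow_lt_of_dist_lt (T : ℝ) {ε : ℝ} (hε : 0 < ε) :
    ∃ ρ > 0, ∀ x y, dist x y < ρ → ∀ s, |s| ≤ T → dist (F s x) (F s y) < ε := by
  have hc : UniformContinuousOn (fun q : ℝ × X => F q.1 q.2) (Icc (-T) T ×ˢ univ) :=
    (isCompact_Icc.prod isCompact_univ).uniformContinuousOn_of_continuous
      F.cont'.continuousOn
  obtain ⟨ρ, hρ, h⟩ := Metric.uniformContinuousOn_iff.1 hc ε hε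
  refine ⟨ρ, hρ, fun x y hxy s hs => ?_⟩
  exact h (s, x) ⟨abs_le.1 hs, mem_univ _⟩ (s, y) ⟨abs_le.1 hs, mem_univ _⟩
    (by simpa [Prod.dist_eq, hρ] using hxy)

lemma exists_dist_flow_lt_of_abs_sub_lt {ε : ℝ} (hε : 0 < ε) :
    ∃ ρ > 0, ∀ (x : X) (r r' : ℝ), |r - r'| < ρ → dist (F r x) (F r' x) < ε := by
  have hc : UniformContinuousOn (fun q : ℝ × X => F q.1 q.2) (Icc (-1) 1 ×ˢ univ) :=
    (isCompact_Icc.prod isCompact_univ).uniformContinuousOn_of_continuous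
      F.cont'.continuousOn
  obtain ⟨ρ, hρ, h⟩ := Metric.uniformContinuousOn_iff.1 hc ε hε
  refine ⟨min ρ 1, by positivity, fun x r r' hr => ?_⟩
  have h1 := h (r - r', F r' x) ⟨abs_le.1 (hr.le.trans (min_le_right _ _)), mem_univ _⟩
    (0, F r' x) ⟨by simp, mem_univ _⟩ (by
      simpa [Prod.dist_eq, Real.dist_eq, hρ] using hr.trans_le (min_le_left _ _))
  simpa [← F.map_add] using h1

/-- There are finite maximal separated sets, and these are spanning. -/
lemma exists_isSeparated_spanning (t : ℝ) {ε : ℝ} (hε : 0 < ε) :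
    ∃ E : Finset X, IsSeparated F t ε (E : Set X) ∧
      ∀ x, ∃ e ∈ E, ∀ s ∈ Icc (0 : ℝ) t, dist (F s x) (F s e) ≤ ε := by
  classical
  borelize X
  obtain ⟨ρ, hρ, hF⟩ := exists_dist_flow_lt_of_dist_lt F t hε
  obtain ⟨k, α, -, hα⟩ := exists_partition_dist_lt (X := X) hρ
  have hcard : ∀ E : Finset X, IsSeparated F t ε (E : Set X) → E.card ≤ k := by
    intro E hE
    have hinj : Set.InjOn α (E : Set X) := by
      intro x hx y hy hxy
      by_contra hne
      obtain ⟨s, hs, hd⟩ := hE x hx y hy hne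
      exact absurd (hF x y (hα x y hxy) s (abs_le.2 ⟨by linarith [hs.1, hs.2], hs.2⟩)) (not_lt.2 hd)
    have := Finset.card_le_card_of_injOn α (fun _ _ => Finset.mem_univ _) hinj
    simpa using this
  let A : Set ℕ := {n | ∃ E : Finset X, IsSeparated F t ε (E : Set X) ∧ E.card = n}
  have hA : A.Nonempty := ⟨0, ∅, by simp [IsSeparated], rfl⟩
  have hAb : BddAbove A := ⟨k, by rintro _ ⟨E, hE, rfl⟩; exact hcard E hE⟩
  obtain ⟨E, hE, hEmax⟩ := Nat.sSup_mem hA hAb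
  refine ⟨E, hE, fun x => ?_⟩
  by_cases hx : x ∈ E
  · exact ⟨x, hx, fun s _ => by simpa using hε.le⟩
  by_contra! hcon
  have hsep : IsSeparated F t ε ((insert x E : Finset X) : Set X) := by
    intro a ha b hb hab
    simp only [Finset.coe_insert, mem_insert_iff, Finset.mem_coe] at ha hb
    rcases ha with rfl | ha <;> rcases hb with rfl | hb
    · exact absurd rfl hab
    · obtain ⟨s, hs, h⟩ := hcon b hb
      exact ⟨s, hs, h.le⟩
    · obtain ⟨s, hs, h⟩ := hcon a ha
      exact ⟨s, hs, by rw [dist_comm]; exact h.le⟩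
    · exact hE a ha b hb hab
  have := le_csSup hAb ⟨_, hsep, rfl⟩
  rw [Finset.card_insert_of_notMem hx] at this
  omega

end FlowEstimates

/-! ### Entropy and topological pressure -/

section Variational

lemma continuous_birkhoff {X : Type*} [TopologicalSpace X] {F : Flow ℝ X} {φ : X → ℝ}
    (hφ : Continuous φ) (t : ℝ) :
    Continuous fun x => ∫ s in (0 : ℝ)..t, φ (F s x) :=
  intervalIntegral.continuous_parametric_intervalIntegral_of_continuous'
    (f := fun x s => φ (F s x)) (hφ.comp (F.cont'.comp continuous_swap)) 0 t

/-- Gibbs' inequality in integrated form. -/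
lemma partitionEntropy_add_integral_le {X : Type*} [MeasurableSpace X] {μ : Measure X}
    [IsProbabilityMeasure μ] {κ : Type*} [Fintype κ] [MeasurableSpace κ]
    [MeasurableSingletonClass κ] {G : X → κ} (hG : Measurable G)
    {ψ : X → ℝ} (hψ : Integrable ψ μ) (u : κ → ℝ) (h : ∀ x, ψ x ≤ u (G x)) :
    partitionEntropy μ G + ∫ x, ψ x ∂μ ≤ Real.log (∑ e, Real.exp (u e)) := by
  have := Measure.isProbabilityMeasure_map (μ := μ) hG.aemeasurable
  have h1 : ∫ x, u (G x) ∂μ = ∑ e, μ.real (G ⁻¹' {e}) * u e := by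
    rw [← integral_map hG.aemeasurable (f := u) (Measurable.of_discrete).aestronglyMeasurable,
      integral_fintype .of_finite]
    simp [map_measureReal_apply hG]
  have h2 : ∫ x, ψ x ∂μ ≤ ∫ x, u (G x) ∂μ :=
    integral_mono hψ ((Integrable.of_finite (f := u) (μ := μ.map G)).comp_measurable hG) h
  have h3 := sum_negMulLog_add_le Finset.univ (fun e => μ.real (G ⁻¹' {e})) u
    fun _ _ => measureReal_nonneg
  rw [sum_real_fibre hG, Finset.sum_add_distrib] at h3
  simp only [Real.negMulLog_one, one_mul, zero_add] at h3
  rw [h1] at h2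
  unfold partitionEntropy
  linarith

lemma log_div_lt_iff {a : ENNReal} {t c : ℝ} (ht : 0 < t) :
    ENNReal.log a / (t : EReal) < (c : EReal) ↔ a < ENNReal.ofReal (Real.exp (c * t)) := by
  rw [EReal.div_lt_iff (by exact_mod_cast ht) (EReal.coe_ne_top t), ← EReal.coe_mul,
    ← ENNReal.log_lt_log_iff, ENNReal.log_ofReal_of_pos (Real.exp_pos _), Real.log_exp]

lemma lt_log_div_iff {a : ENNReal} {t c : ℝ} (ht : 0 < t) :
    (c : EReal) < ENNReal.log a / (t : EReal) ↔ ENNReal.ofReal (Real.exp (c * t)) < a := by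
  rw [EReal.lt_div_iff (by exact_mod_cast ht) (EReal.coe_ne_top t), ← EReal.coe_mul,
    ← ENNReal.log_lt_log_iff, ENNReal.log_ofReal_of_pos (Real.exp_pos _), Real.log_exp]

variable {X : Type*} [MetricSpace X]

lemma eventually_sum_exp_le {F : Flow ℝ X} {φ : X → ℝ} {ε p : ℝ} (hε : 0 < ε)
    (hp : topPressure F φ < (p : EReal)) :
    ∀ᶠ t : ℝ in atTop, ∀ E : Finset X, IsSeparated F t ε (E : Set X) →
      ∑ x ∈ E, Real.exp (∫ s in (0 : ℝ)..t, φ (F s x)) ≤ Real.exp (p * t) := by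
  have h : pressureAtScale F φ ε < (p : EReal) :=
    (le_iSup₂ (f := fun (ε : ℝ) (_ : 0 < ε) => pressureAtScale F φ ε) ε hε).trans_lt hp
  filter_upwards [eventually_lt_of_limsup_lt h, eventually_gt_atTop 0] with t ht h0 E hE
  rw [log_div_lt_iff h0] at ht
  have h1 := (le_iSup₂ (f := fun (E : Finset X) (_ : IsSeparated F t ε (E : Set X)) =>
    ∑ x ∈ E, ENNReal.ofReal (Real.exp (∫ s in (0 : ℝ)..t, φ (F s x)))) E hE).trans ht.le
  rw [← ENNReal.ofReal_sum_of_nonneg fun _ _ => (Real.exp_pos _).le] at h1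
  exact (ENNReal.ofReal_le_ofReal_iff (Real.exp_pos _).le).1 h1

variable [CompactSpace X] [MeasurableSpace X] [BorelSpace X]

lemma integrable_of_continuous {μ : Measure X} [IsFiniteMeasure μ] {f : X → ℝ}
    (hf : Continuous f) : Integrable f μ :=
  hf.integrable_of_hasCompactSupport (HasCompactSupport.of_compactSpace f)

/-- Integrating a Birkhoff integral against an invariant measure. -/
lemma integral_birkhoff {F : Flow ℝ X} {φ : X → ℝ} (hφ : Continuous φ) {μ : Measure X}
    (hμ : IsInvariantProb F μ) {t : ℝ} :
    ∫ x, (∫ s in (0 : ℝ)..t, φ (F s x)) ∂μ = t * ∫ x, φ x ∂μ := by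
  have := hμ.isProbabilityMeasure
  obtain ⟨C, hC⟩ := (isCompact_range hφ).isBounded.exists_norm_le
  have hc : Continuous (Function.uncurry fun (s : ℝ) (x : X) => φ (F s x)) := hφ.comp F.cont'
  have : IsFiniteMeasure ((volume : Measure ℝ).restrict (uIoc 0 t)) :=
    isFiniteMeasure_restrict.2 (by simp [uIoc])
  have hint : Integrable (Function.uncurry fun (s : ℝ) (x : X) => φ (F s x))
      ((volume.restrict (uIoc 0 t)).prod μ) :=
    Integrable.of_bound hc.aestronglyMeasurable C
      (Eventually.of_forall fun q => hC _ (mem_range_self _))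
  rw [← intervalIntegral_integral_swap hint]
  have : ∀ s : ℝ, ∫ x, φ (F s x) ∂μ = ∫ x, φ x ∂μ := fun s => by
    rw [← integral_map (hμ.measurePreserving s).measurable.aemeasurable
      hφ.aestronglyMeasurable, (hμ.measurePreserving s).map_eq]
  simp [this]

/-- Misiurewicz' estimate. The errors `log 2 + 1` come from the compact approximation of the
partition `⋁_{i < m} f_{-i} ξ`; they are incurred once per `m` units of time. -/
lemma partitionEntropyRate_le_of_topPressure_lt {F : Flow ℝ X} {φ : X → ℝ} (hφ : Continuous φ)
    {μ : Measure X} (hμ : IsInvariantProb F μ) {k : ℕ} {ξ : X → Fin k} (hξ : Measurable ξ) {p : ℝ}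
    (hp : topPressure F φ < (p : EReal)) {m : ℕ} (hm : 0 < m) {τ : ℝ} (hτ : 0 < τ) :
    partitionEntropyRate μ (F 1) ξ ≤
      ((p - ∫ x, φ x ∂μ + τ + (Real.log 2 + 1) / m : ℝ) : EReal) := by
  classical
  have := hμ.isProbabilityMeasure
  obtain ⟨x₀⟩ : Nonempty X := nonempty_of_isProbabilityMeasure μ
  have hT := hμ.measurePreserving 1
  have hTm := hT.iterate m
  set ζ := refinement (F 1) ξ m
  have hζ : Measurable ζ := measurable_refinement hT.measurable hξ m
  have : Nonempty (Fin m → Fin k) := ⟨ζ x₀⟩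
  let _ : MeasurableSpace (Option (Fin m → Fin k)) := ⊤
  obtain ⟨η, δ, j, hη, hδ, hj, hcond⟩ := exists_compact_refinement_condEntropy μ hζ
  obtain ⟨δ₁, hδ₁, hφu⟩ := Metric.uniformContinuous_iff.1
    (CompactSpace.uniformContinuous_of_continuous hφ) τ hτ
  set δ' := min δ δ₁ / 2 with hδ'
  have hδ'0 : 0 < δ' := by positivity
  have hδ'1 : δ' < δ := by have := min_le_left δ δ₁; linarith
  have hδ'2 : δ' < δ₁ := by have := min_le_right δ δ₁; linarith
  have htime : Tendsto (fun n : ℕ => (n : ℝ) * m) atTop atTop :=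
    tendsto_natCast_atTop_atTop.atTop_mul_const (by exact_mod_cast hm)
  have hm0 : (0 : ℝ) < m := by exact_mod_cast hm
  refine partitionEntropyRate_le hT.measurable hξ hm (b := 0) ?_
  filter_upwards [htime.eventually (eventually_sum_exp_le hδ'0 hp)] with n hn
  obtain ⟨E, hE, hspan⟩ := exists_isSeparated_spanning F ((n : ℝ) * m) hδ'0
  let _ : MeasurableSpace E := ⊤
  -- a measurable assignment of points to the elements of `E` whose orbits they follow
  obtain ⟨G, hG, hGs⟩ := exists_measurable_choice (ι := E)
    (fun e => {x | ∀ s ∈ Icc (0 : ℝ) ((n : ℝ) * m), dist (F s x) (F s e) ≤ δ'})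
    (fun e => by
      have : IsClosed {x | ∀ s ∈ Icc (0 : ℝ) ((n : ℝ) * m), dist (F s x) (F s e) ≤ δ'} := by
        simp only [ofPred_forall]
        exact isClosed_biInter fun s _ =>
          isClosed_le ((F.continuous_toFun s).dist continuous_const) continuous_const
      exact this.measurableSet)
    (fun x => by obtain ⟨e, he, h⟩ := hspan x; exact ⟨⟨e, he⟩, h⟩)
  have hηn : Measurable (refinement (F 1)^[m] η n) := measurable_refinement hTm.measurable hη n
  -- along the orbit of `e`, only two cells of `η` are visible at each time
  set S : E → Finset (Fin n → Option (Fin m → Fin k)) := fun e =>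
    Fintype.piFinset fun i => {none, some (j (F ((i * m : ℕ) : ℝ) e))} with hS
  have hSmem : ∀ x, refinement (F 1)^[m] η n x ∈ S (G x) := by
    intro x
    simp only [hS, Fintype.mem_piFinset, refinement, Finset.mem_insert, Finset.mem_singleton]
    intro i
    rw [← Function.iterate_mul, flow_one_iterate, mul_comm m]
    refine hj _ _ ((hGs x _ ⟨by positivity, ?_⟩).trans_lt hδ'1)
    have : (i : ℕ) ≤ n := i.2.le
    push_cast
    gcongr
  have hScard : ∀ e, Real.log (S e).card ≤ n * Real.log 2 := by
    intro e
    have h1 : (S e).card ≤ 2 ^ n := by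
      rw [hS, Fintype.card_piFinset]
      refine (Finset.prod_le_pow_card _ _ 2 fun i _ => Finset.card_le_two).trans (by simp)
    rcases (S e).card.eq_zero_or_pos with h0 | h0
    · rw [h0]; simp; positivity
    · rw [← Real.log_pow]
      exact Real.log_le_log (by exact_mod_cast h0) (by exact_mod_cast h1)
  have h1 := partitionEntropy_refinement_mul_le (μ := μ) hT.measurable hξ hm n
  have h2 := partitionEntropy_refinement_le_add hTm hζ hη n
  have h3 : partitionEntropy μ (refinement (F 1)^[m] η n) ≤
      partitionEntropy μ (fun x => (refinement (F 1)^[m] η n x, G x)) :=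
    partitionEntropy_le_of_factor (hηn.prodMk hG) Prod.fst fun _ => rfl
  have h4 := condEntropy_le_sum_log_card (μ := μ) hηn hG S hSmem
  have h5 : ∑ e, μ.real (G ⁻¹' {e}) * Real.log (S e).card ≤ n * Real.log 2 := by
    calc _ ≤ ∑ e, μ.real (G ⁻¹' {e}) * (n * Real.log 2) :=
          Finset.sum_le_sum fun e _ => mul_le_mul_of_nonneg_left (hScard e) measureReal_nonneg
      _ = _ := by rw [← Finset.sum_mul, sum_real_fibre hG, one_mul]
  -- Gibbs' inequality for the Birkhoff integrals of `φ`
  set ψ : X → ℝ := fun x => ∫ s in (0 : ℝ)..((n : ℝ) * m), φ (F s x) with hψ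
  have hψle : ∀ x, ψ x ≤ ψ (G x) + n * m * τ := by
    intro x
    have hci : ∀ y, IntervalIntegrable (fun s => φ (F s y)) volume 0 ((n : ℝ) * m) := fun y =>
      (hφ.comp (F.continuous continuous_id continuous_const)).intervalIntegrable _ _
    have : ψ x ≤ ∫ s in (0 : ℝ)..((n : ℝ) * m), (φ (F s (G x)) + τ) := by
      refine intervalIntegral.integral_mono_on (by positivity) (hci x)
        ((hci _).add intervalIntegrable_const) fun s hs => ?_
      have := hφu ((hGs x s hs).trans_lt hδ'2)
      rw [Real.dist_eq] at this
      linarith [(abs_lt.1 this).2]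
    rw [intervalIntegral.integral_add (hci _) intervalIntegrable_const] at this
    simpa using this
  have h6 := partitionEntropy_add_integral_le hG
    (integrable_of_continuous (μ := μ) (continuous_birkhoff (F := F) hφ ((n : ℝ) * m)))
    (fun e => ψ e + n * m * τ) hψle
  rw [integral_birkhoff hφ hμ] at h6
  have hEne : (Finset.univ : Finset E).Nonempty := ⟨G x₀, Finset.mem_univ _⟩
  have h7 : Real.log (∑ e : E, Real.exp (ψ e + n * m * τ)) ≤ p * (n * m) + n * m * τ := by
    have hpos : 0 < ∑ e : E, Real.exp (ψ e) := Finset.sum_pos (fun _ _ => Real.exp_pos _) hEne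
    simp only [Real.exp_add]
    rw [← Finset.sum_mul, Real.log_mul hpos.ne' (Real.exp_pos _).ne', Real.log_exp]
    have := hn E hE
    rw [← Finset.sum_coe_sort] at this
    have := Real.log_le_log hpos this
    rw [Real.log_exp] at this
    linarith
  have h8 : (n : ℝ) * condEntropy μ ζ η ≤ n := by
    have := mul_le_mul_of_nonneg_left hcond (Nat.cast_nonneg (α := ℝ) n)
    linarith
  have h9 : (n : ℝ) * m * ((Real.log 2 + 1) / m) = n * Real.log 2 + n := by
    field_simp
  unfold condEntropy at h4
  have h10 : (n : ℝ) * m * (p - ∫ x, φ x ∂μ + τ + (Real.log 2 + 1) / m) =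
      p * (n * m) - n * m * ∫ x, φ x ∂μ + n * m * τ + (n * Real.log 2 + n) := by
    rw [← h9]; ring
  rw [h10]
  linarith

/-- The half of the variational principle which bounds measure-theoretic pressure by topological
pressure. -/
theorem measurePressure_le_topPressure {F : Flow ℝ X} {φ : X → ℝ} (hφ : Continuous φ)
    {μ : Measure X} (hμ : IsInvariantProb F μ) : measurePressure F φ μ ≤ topPressure F φ := by
  refine EReal.le_of_forall_lt_iff_le.1 fun p hp => ?_
  suffices h : entropy μ (F 1) ≤ ((p - ∫ x, φ x ∂μ : ℝ) : EReal) by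
    refine (add_le_add_left h _).trans (le_of_eq ?_)
    rw [← EReal.coe_add, sub_add_cancel]
  refine iSup_le fun k => iSup_le fun ξ => iSup_le fun hξ =>
    EReal.le_of_forall_lt_iff_le.1 fun q hq => ?_
  rw [EReal.coe_lt_coe_iff] at hq
  set τ := (q - (p - ∫ x, φ x ∂μ)) / 2 with hτ
  have hτ0 : 0 < τ := by linarith
  obtain ⟨m, hm⟩ := exists_nat_gt ((Real.log 2 + 1) / τ)
  have hm0 : (0 : ℝ) < m := lt_of_le_of_lt (by positivity) hm
  refine (partitionEntropyRate_le_of_topPressure_lt hφ hμ hξ hp (m := m)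
    (by exact_mod_cast hm0) hτ0).trans ?_
  rw [EReal.coe_le_coe_iff]
  have : (Real.log 2 + 1) / m < τ := by
    rw [div_lt_iff₀ hτ0] at hm
    rw [div_lt_iff₀ hm0]
    linarith
  linarith

end Variational

/-! ### Non-expansive points -/

section NonExpansive

variable {X : Type*} [MetricSpace X] {F : Flow ℝ X}

/-- The points `x` for which some `y` follows `x` up to `ε` at all times in `A`, but stays `c`-away
from the orbit segment `f_{[-s,s]}(x)`. -/
def escapeSet {X : Type*} [MetricSpace X] (F : Flow ℝ X) (ε : ℝ) (A : Set ℝ) (s c : ℝ) : Set X :=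
  {x | ∃ y, (∀ t ∈ A, dist (F t x) (F t y) ≤ ε) ∧ ∀ r ∈ Icc (-s) s, c ≤ dist (F r x) y}

lemma isClosed_escape_pair (F : Flow ℝ X) (ε : ℝ) (A : Set ℝ) (s c : ℝ) :
    IsClosed {q : X × X | (∀ t ∈ A, dist (F t q.1) (F t q.2) ≤ ε) ∧
      ∀ r ∈ Icc (-s) s, c ≤ dist (F r q.1) q.2} := by
  simp only [ofPred_and, ofPred_forall]
  exact (isClosed_biInter fun t _ => isClosed_le
      (((F.continuous_toFun t).comp continuous_fst).dist
        ((F.continuous_toFun t).comp continuous_snd)) continuous_const).inter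
    (isClosed_biInter fun r _ => isClosed_le continuous_const
      (((F.continuous_toFun r).comp continuous_fst).dist continuous_snd))

lemma isClosed_escapeSet [CompactSpace X] (F : Flow ℝ X) (ε : ℝ) (A : Set ℝ) (s c : ℝ) :
    IsClosed (escapeSet F ε A s c) := by
  have h := ((isClosed_escape_pair F ε A s c).isCompact.image continuous_fst).isClosed
  convert h using 1
  ext x
  simp [escapeSet]

lemma not_subset_orbitSegment_iff {ε s : ℝ} {x : X} :
    ¬ shadowSet F ε x ⊆ orbitSegment F s x ↔ ∃ n : ℕ, x ∈ escapeSet F ε univ s (1 / (n + 1)) := by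
  have hseg : IsClosed (orbitSegment F s x) :=
    (isCompact_Icc.image (F.continuous continuous_id continuous_const)).isClosed
  rw [not_subset]
  constructor
  · rintro ⟨y, hy, hys⟩
    obtain ⟨c, hc, hball⟩ := Metric.isOpen_iff.1 hseg.isOpen_compl y hys
    obtain ⟨n, hn⟩ := exists_nat_one_div_lt hc
    refine ⟨n, y, fun t _ => hy t, fun r hr => ?_⟩
    by_contra! hlt
    exact hball (Metric.mem_ball.2 (hlt.trans hn)) ⟨r, hr, rfl⟩
  · rintro ⟨n, y, hy, hr⟩
    refine ⟨y, fun t => hy t (mem_univ t), ?_⟩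
    rintro ⟨r, hrs, rfl⟩
    have h1 := hr r hrs
    rw [dist_self] at h1
    have : (0 : ℝ) < 1 / (n + 1) := by positivity
    linarith

lemma orbitSegment_mono (x : X) {s s' : ℝ} (h : s ≤ s') :
    orbitSegment F s x ⊆ orbitSegment F s' x :=
  image_mono (Icc_subset_Icc (neg_le_neg h) h)

lemma nonExpansiveSet_eq_iInter (F : Flow ℝ X) (ε : ℝ) :
    nonExpansiveSet F ε = ⋂ m : ℕ, ⋃ n : ℕ, escapeSet F ε univ (m + 1) (1 / (n + 1)) := by
  ext x
  simp only [mem_iInter, mem_iUnion, ← not_subset_orbitSegment_iff]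
  refine ⟨fun h m => h _ (by positivity), fun h s _ hs => ?_⟩
  obtain ⟨m, hm⟩ := exists_nat_ge s
  exact h m (hs.trans (orbitSegment_mono x (by linarith)))

/-- The non-expansive set is Borel: projections of closed subsets of `X × X` are closed. -/
lemma measurableSet_nonExpansiveSet [CompactSpace X] [MeasurableSpace X] [BorelSpace X]
    (F : Flow ℝ X) (ε : ℝ) : MeasurableSet (nonExpansiveSet F ε) := by
  rw [nonExpansiveSet_eq_iInter]
  exact MeasurableSet.iInter fun m => MeasurableSet.iUnion fun n =>
    (isClosed_escapeSet F ε _ _ _).measurableSet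

lemma nonExpansiveSet_mono {ε ε' : ℝ} (h : ε ≤ ε') :
    nonExpansiveSet F ε ⊆ nonExpansiveSet F ε' := fun _ hx s hs hsub =>
  hx s hs (Subset.trans (fun _ hy t => (hy t).trans h) hsub)

lemma flow_mem_nonExpansiveSet {ε t : ℝ} {x : X} (hx : x ∈ nonExpansiveSet F ε) :
    F t x ∈ nonExpansiveSet F ε := by
  intro s hs hsub
  refine hx s hs fun y hy => ?_
  have hy' : F t y ∈ shadowSet F ε (F t x) := fun r => by
    rw [← F.map_add, ← F.map_add]; exact hy _
  obtain ⟨r, hr, h⟩ := hsub hy'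
  refine ⟨r, hr, ?_⟩
  have h' := congrArg (F (-t)) h
  rw [flow_neg_apply] at h'
  rw [← h']
  simp only [← F.map_add]
  congr 1
  ring

lemma preimage_nonExpansiveSet (F : Flow ℝ X) (ε t : ℝ) :
    F t ⁻¹' nonExpansiveSet F ε = nonExpansiveSet F ε := by
  ext x
  refine ⟨fun h => ?_, flow_mem_nonExpansiveSet⟩
  have := flow_mem_nonExpansiveSet (t := -t) h
  rwa [flow_neg_apply] at this

/-- If the points shadowing `x` for all time lie on a short orbit segment, then the points shadowing
`x` for a long time are close to that segment. -/
lemma exists_notMem_escapeSet [CompactSpace X] {ε s c : ℝ} (hc : 0 < c) {x : X}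
    (hx : shadowSet F ε x ⊆ orbitSegment F s x) :
    ∃ N : ℕ, x ∉ escapeSet F ε (Icc (-N : ℝ) N) s c := by
  by_contra! hcon
  let V : ℕ → Set X := fun N => {y | (∀ t ∈ Icc (-N : ℝ) N, dist (F t x) (F t y) ≤ ε) ∧
    ∀ r ∈ Icc (-s) s, c ≤ dist (F r x) y}
  have hVcl : ∀ N, IsClosed (V N) := fun N =>
    (isClosed_escape_pair F ε (Icc (-N : ℝ) N) s c).preimage
      (continuous_const.prodMk continuous_id : Continuous fun y => (x, y))
  obtain ⟨y, hy⟩ := IsCompact.nonempty_iInter_of_sequence_nonempty_isCompact_isClosed V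
    (fun N y hy => ⟨fun t ht => hy.1 t ⟨by push_cast; linarith [ht.1], by
      push_cast; linarith [ht.2]⟩, hy.2⟩)
    (fun N => hcon N) (hVcl 0).isCompact hVcl
  rw [mem_iInter] at hy
  have hsh : y ∈ shadowSet F ε x := fun t => by
    obtain ⟨N, hN⟩ := exists_nat_ge |t|
    exact (hy N).1 t (abs_le.1 hN)
  obtain ⟨r, hr, rfl⟩ := hx hsh
  have := (hy 0).2 r hr
  rw [dist_self] at this
  linarith

/-- For a measure not charging the non-expansive set, most points are such that whatever shadows
them for a long time is close to a short orbit segment. -/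
lemma exists_measure_escapeSet_lt [CompactSpace X] [MeasurableSpace X] [BorelSpace X]
    {μ : Measure X} [IsProbabilityMeasure μ] {ε : ℝ} (h0 : μ (nonExpansiveSet F ε) = 0) {κ : ℝ}
    (hκ : 0 < κ) :
    ∃ S : ℕ, ∀ c > 0, ∃ N : ℕ, μ.real (escapeSet F ε (Icc (-N : ℝ) N) S c) < κ := by
  set G : ℕ → Set X := fun S => {x | shadowSet F ε x ⊆ orbitSegment F S x}
  have hG : Monotone G := fun S S' h x hx =>
    Subset.trans hx (orbitSegment_mono x (by exact_mod_cast h))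
  have hGun : μ (⋃ S, G S) = 1 := by
    refine le_antisymm prob_le_one ?_
    rw [← (prob_compl_eq_one_iff (measurableSet_nonExpansiveSet F ε)).2 h0]
    refine measure_mono fun x hx => ?_
    simp only [nonExpansiveSet, mem_compl_iff, mem_ofPred_eq, not_forall, not_not] at hx
    obtain ⟨s, hs, hsub⟩ := hx
    obtain ⟨n, hn⟩ := exists_nat_ge s
    exact mem_iUnion.2 ⟨n, hsub.trans (orbitSegment_mono x hn)⟩
  have hlt : 1 - ENNReal.ofReal κ < 1 :=
    ENNReal.sub_lt_self ENNReal.one_ne_top one_ne_zero (by simpa using hκ)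
  have hlim := tendsto_measure_iUnion_atTop (μ := μ) hG
  rw [hGun] at hlim
  obtain ⟨S, hS⟩ := (hlim.eventually (lt_mem_nhds hlt)).exists
  refine ⟨S, fun c hc => ?_⟩
  set K : ℕ → Set X := fun N => (escapeSet F ε (Icc (-N : ℝ) N) S c)ᶜ
  have hK : Monotone K := fun N N' h x hx ⟨y, hy⟩ => hx ⟨y, fun t ht => hy.1 t
    ⟨(neg_le_neg (by exact_mod_cast h)).trans ht.1, ht.2.trans (by exact_mod_cast h)⟩, hy.2⟩
  have hsub : G S ⊆ ⋃ N, K N := fun x hx => mem_iUnion.2 (exists_notMem_escapeSet hc hx)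
  obtain ⟨N, hN⟩ := ((tendsto_measure_iUnion_atTop (μ := μ) hK).eventually
    (lt_mem_nhds (hS.trans_le (measure_mono hsub)))).exists
  refine ⟨N, ?_⟩
  have hm := (isClosed_escapeSet F ε (Icc (-N : ℝ) N) S c).measurableSet
  have h2 : 1 - ENNReal.ofReal κ < 1 - μ (escapeSet F ε (Icc (-N : ℝ) N) S c) := by
    rw [← prob_compl_eq_one_sub hm]; exact hN
  have h3 : μ (escapeSet F ε (Icc (-N : ℝ) N) S c) < ENNReal.ofReal κ :=
    lt_of_tsub_lt_tsub_left h2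
  rw [Measure.real]
  exact (ENNReal.toReal_lt_of_lt_ofReal h3)

end NonExpansive

/-! ### Finiteness of entropy away from the non-expansive set -/

section FiniteEntropy

/-- Points with the same itinerary over the integers in `[-N, N]`, with respect to a partition whose
cells stay small for one unit of time, shadow each other throughout `[-N, N]`. -/
lemma dist_flow_le_of_refinement_eq {X ι : Type*} [MetricSpace X] {F : Flow ℝ X} {ε ρ : ℝ}
    {α : X → ι}
    (hρ : ∀ x y, dist x y < ρ → ∀ s, |s| ≤ 1 → dist (F s x) (F s y) < ε)
    (hα : ∀ x y, α x = α y → dist x y < ρ) {N : ℕ} {x y : X}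
    (h : refinement (F 1) α (2 * N + 1) (F (-N) x) = refinement (F 1) α (2 * N + 1) (F (-N) y))
    {t : ℝ} (ht : t ∈ Icc (-N : ℝ) N) : dist (F t x) (F t y) ≤ ε := by
  have hu : 0 ≤ t + N := by linarith [ht.1]
  set i := ⌊t + N⌋₊ with hi
  have hi1 : (i : ℝ) ≤ t + N := Nat.floor_le hu
  have hi2 : t + N < i + 1 := Nat.lt_floor_add_one _
  have hi3 : i < 2 * N + 1 := by
    have : (i : ℝ) < 2 * N + 1 := by linarith [ht.2]
    exact_mod_cast this
  have h1 := congrFun h ⟨i, hi3⟩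
  simp only [refinement, flow_one_iterate] at h1
  have h2 := hρ _ _ (hα _ _ h1) (t + N - i) (abs_le.2 ⟨by linarith, by linarith⟩)
  simp only [← F.map_add] at h2
  have e : t + N - i + ((i : ℝ) + -N) = t := by ring
  rw [e] at h2
  exact h2.le

/-- The refinements under `f_M` of an itinerary over `[-N, N]` have entropy growing at most at the
rate given by the number of symbols. -/
lemma partitionEntropy_refinement_itinerary_le {X : Type*} [TopologicalSpace X]
    [MeasurableSpace X] {F : Flow ℝ X} {μ : Measure X} (hμ : IsInvariantProb F μ)
    {k : ℕ} {α : X → Fin k} (hα : Measurable α) (M N n : ℕ) :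
    partitionEntropy μ (refinement (F 1)^[M]
      (fun x => refinement (F 1) α (2 * N + 1) (F (-N) x)) n) ≤
      (n * M + (2 * N + 1) : ℕ) * Real.log k := by
  have := hμ.isProbabilityMeasure
  have hF := fun t => (hμ.measurePreserving t).measurable
  have hm : Measurable (fun x => refinement (F 1) α (n * M + (2 * N + 1)) (F (-N) x)) :=
    (measurable_refinement (hF 1) hα _).comp (hF _)
  refine (partitionEntropy_le_of_factor hm
    (fun (y : Fin (n * M + (2 * N + 1)) → Fin k) (i : Fin n) (l : Fin (2 * N + 1)) =>
      y ⟨i * M + l, ?_⟩) fun x => ?_).trans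
    ((partitionEntropy_le_log_card hm).trans (le_of_eq ?_))
  · have : (i : ℕ) * M ≤ n * M := Nat.mul_le_mul_right _ i.2.le
    have := l.2
    omega
  · funext i l
    simp only [refinement, ← Function.iterate_mul, flow_one_iterate, ← F.map_add]
    congr 2
    push_cast
    ring
  · simp [Real.log_pow]

variable {X : Type*} [MetricSpace X] [CompactSpace X] [MeasurableSpace X] [BorelSpace X]
  {F : Flow ℝ X} {μ : Measure X}

/-- A measure which does not charge the non-expansive set at some scale has finite entropy. The
two-sided itineraries with respect to a fine partition determine points up to bounded motion along
the orbit, so that every other partition contributes only a bounded amount of entropy. -/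
theorem entropy_lt_top_of_measure_nonExpansiveSet_eq_zero (hμ : IsInvariantProb F μ) {ε : ℝ}
    (hε : 0 < ε) (h0 : μ (nonExpansiveSet F ε) = 0) : entropy μ (F 1) < ⊤ := by
  classical
  have := hμ.isProbabilityMeasure
  obtain ⟨x₀⟩ : Nonempty X := nonempty_of_isProbabilityMeasure μ
  have hF := fun t => (hμ.measurePreserving t).measurable
  have hT := hμ.measurePreserving 1
  obtain ⟨ρ, hρ, hFρ⟩ := exists_dist_flow_lt_of_dist_lt F 1 hε
  obtain ⟨k₀, α, hα, hαd⟩ := exists_partition_dist_lt (X := X) hρ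
  suffices h : entropy μ (F 1) ≤ ((Real.log k₀ + Real.log 2 + 3 : ℝ) : EReal) from
    h.trans_lt (EReal.coe_lt_top _)
  refine iSup_le fun k => iSup_le fun ξ => iSup_le fun hξ => ?_
  have : Nonempty (Fin k) := ⟨ξ x₀⟩
  let _ : MeasurableSpace (Option (Fin k)) := ⊤
  obtain ⟨η, δ, j, hη, hδ, hj, hcond⟩ := exists_compact_refinement_condEntropy μ hξ
  obtain ⟨ρ₁, hρ₁, hFρ₁⟩ := exists_dist_flow_lt_of_abs_sub_lt F (half_pos hδ)
  have hk1 : 0 ≤ Real.log (k + 1 : ℝ) := Real.log_nonneg (by simp)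
  -- the measure of the bad points is so small that counting all `η`-names on them costs at most `1`
  -- per unit of time
  obtain ⟨S, hS⟩ := exists_measure_escapeSet_lt (F := F) h0
    (κ := 1 / (Real.log (k + 1 : ℝ) + 1)) (by positivity)
  -- a finite set of times which is `ρ₁`-dense in `[-S, S]`
  obtain ⟨R₀, -, hR₀f, hR₀⟩ := Metric.finite_approx_of_totallyBounded
    (isCompact_Icc (a := (-S : ℝ)) (b := S)).totallyBounded ρ₁ hρ₁
  set R : Finset ℝ := hR₀f.toFinset with hR
  -- the choice of a time in `R` is made once per block of length `M`, at the cost `log #R ≤ M`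
  obtain ⟨M, hM⟩ := exists_nat_gt (max (Real.log R.card) 0)
  have hM0 : 0 < M := by exact_mod_cast (le_max_right _ _).trans_lt hM
  have hMR : Real.log R.card ≤ M := (le_max_left _ _).trans hM.le
  obtain ⟨c, hc, hFc⟩ := exists_dist_flow_lt_of_dist_lt F M (half_pos hδ)
  obtain ⟨N, hN⟩ := hS c hc
  set B := escapeSet F ε (Icc (-N : ℝ) N) S c with hB
  set β : X → (Fin (2 * N + 1) → Fin k₀) := fun x =>
    refinement (F 1) α (2 * N + 1) (F (-N) x) with hβ
  have hβm : Measurable β := (measurable_refinement (hF 1) hα _).comp (hF _)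
  have hηM : Measurable (refinement (F 1) η M) := measurable_refinement (hF 1) hη M
  -- contains all `η`-names of length `M` which occur on the cell of `β` containing `x ∉ B`
  let W : X → Finset (Fin M → Option (Fin k)) := fun x =>
    R.biUnion fun r => Fintype.piFinset fun i => {none, some (j (F (i : ℕ) (F r x)))}
  have hW : ∀ x y, x ∉ B → β y = β x → refinement (F 1) η M y ∈ W x := by
    intro x y hx hxy
    have hsh : ∀ t ∈ Icc (-N : ℝ) N, dist (F t x) (F t y) ≤ ε := fun t ht =>
      dist_flow_le_of_refinement_eq hFρ hαd hxy.symm ht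
    have : ∃ r ∈ Icc (-S : ℝ) S, dist (F r x) y < c := by
      by_contra! hcon
      exact hx ⟨y, hsh, hcon⟩
    obtain ⟨r, hr, hry⟩ := this
    have := hR₀ hr
    simp only [mem_iUnion, Metric.mem_ball, Real.dist_eq] at this
    obtain ⟨r', hr', hrr'⟩ := this
    refine Finset.mem_biUnion.2 ⟨r', by simpa [hR] using hr', ?_⟩
    simp only [Fintype.mem_piFinset, refinement, Finset.mem_insert, Finset.mem_singleton,
      flow_one_iterate]
    intro i
    refine hj _ _ ?_
    have h1 := hFc _ _ hry (i : ℕ) (by rw [Nat.abs_cast]; exact_mod_cast i.2.le)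
    have h2 := hFρ₁ x ((i : ℕ) + r) ((i : ℕ) + r') (by rwa [add_sub_add_left_eq_sub])
    rw [F.map_add, F.map_add] at h2
    have := dist_triangle_left (F (i : ℕ) y) (F (i : ℕ) (F r' x)) (F (i : ℕ) (F r x))
    linarith
  have hWcard : ∀ x, Real.log (W x).card ≤ M * (Real.log 2 + 1) := by
    intro x
    have h1 : (W x).card ≤ R.card * 2 ^ M := by
      refine Finset.card_biUnion_le_card_mul _ _ _ fun r _ => ?_
      rw [Fintype.card_piFinset]
      exact (Finset.prod_le_pow_card _ _ 2 fun i _ => Finset.card_le_two).trans (by simp)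
    rcases (W x).card.eq_zero_or_pos with h2 | h2
    · rw [h2]; simp; positivity
    · have hR0 : 0 < R.card := Nat.pos_of_mul_pos_right (h2.trans_le h1)
      have h3 : Real.log (W x).card ≤ Real.log ((R.card : ℝ) * 2 ^ M) :=
        Real.log_le_log (by exact_mod_cast h2) (by exact_mod_cast h1)
      rw [Real.log_mul (by positivity) (by positivity), Real.log_pow] at h3
      linarith
  let good : Set (Fin (2 * N + 1) → Fin k₀) := {d | ∃ x, x ∉ B ∧ β x = d}
  let V : (Fin (2 * N + 1) → Fin k₀) → Finset (Fin M → Option (Fin k)) := fun d =>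
    if h : d ∈ good then W h.choose else Finset.univ
  have hV : ∀ y, refinement (F 1) η M y ∈ V (β y) := by
    intro y
    by_cases h : β y ∈ good
    · simp only [V, h, dif_pos]
      exact hW _ _ h.choose_spec.1 h.choose_spec.2.symm
    · simp [V, h]
  have hcondM : condEntropy μ (refinement (F 1) η M) β ≤ M * (Real.log 2 + 2) := by
    refine (condEntropy_le_sum_log_card (μ := μ) hηM hβm V hV).trans ?_
    have hbad : ∑ d with d ∉ good, μ.real (β ⁻¹' {d}) ≤ 1 / (Real.log (k + 1 : ℝ) + 1) := by
      rw [sum_real_preimage hβm]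
      refine (measureReal_mono ?_).trans hN.le
      intro x hx
      by_contra hxB
      simp only [mem_preimage, Finset.coe_filter, Finset.mem_univ, true_and, mem_ofPred_eq] at hx
      exact hx ⟨x, hxB, rfl⟩
    calc ∑ d, μ.real (β ⁻¹' {d}) * Real.log (V d).card
        ≤ ∑ d, (μ.real (β ⁻¹' {d}) * (M * (Real.log 2 + 1)) +
            if d ∉ good then μ.real (β ⁻¹' {d}) * (M * Real.log (k + 1 : ℝ)) else 0) := by
          refine Finset.sum_le_sum fun d _ => ?_
          by_cases h : d ∈ good
          · simp only [V, h, dif_pos, not_true_eq_false, if_false, add_zero]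
            exact mul_le_mul_of_nonneg_left (hWcard _) measureReal_nonneg
          · simp only [V, h, dif_neg, not_false_eq_true, if_true]
            have : Real.log (Finset.univ : Finset (Fin M → Option (Fin k))).card =
                M * Real.log (k + 1 : ℝ) := by
              simp [Real.log_pow]
            rw [this]
            have : 0 ≤ μ.real (β ⁻¹' {d}) * (M * (Real.log 2 + 1)) := by positivity
            linarith
      _ = M * (Real.log 2 + 1) +
          (∑ d with d ∉ good, μ.real (β ⁻¹' {d})) * (M * Real.log (k + 1 : ℝ)) := by
          rw [Finset.sum_add_distrib, ← Finset.sum_mul, sum_real_fibre hβm, one_mul,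
            ← Finset.sum_filter, ← Finset.sum_mul]
      _ ≤ M * (Real.log 2 + 1) + M := by
          gcongr
          calc _ ≤ 1 / (Real.log (k + 1 : ℝ) + 1) * (M * Real.log (k + 1 : ℝ)) := by gcongr
            _ ≤ M := by
              rw [div_mul_eq_mul_div, one_mul, div_le_iff₀ (by positivity)]
              have : (0 : ℝ) ≤ M := M.cast_nonneg
              linarith
      _ = _ := by ring
  refine partitionEntropyRate_le hT.measurable hξ hM0 (b := (2 * N + 1) * Real.log k₀)
    (Eventually.of_forall fun n => ?_)
  have h1 := partitionEntropy_refinement_le_add hT hξ hη (n * M)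
  have h2 := partitionEntropy_refinement_mul_le (μ := μ) hT.measurable hη hM0 n
  have h3 := partitionEntropy_refinement_le_add (hT.iterate M) hηM hβm n
  have h4 := partitionEntropy_refinement_itinerary_le hμ hα M N n
  have h5 := mul_le_mul_of_nonneg_left hcondM (Nat.cast_nonneg (α := ℝ) n)
  have h6 := mul_le_mul_of_nonneg_left hcond (Nat.cast_nonneg (α := ℝ) (n * M))
  push_cast at h1 h4 h6
  linarith

end FiniteEntropy

/-! ### Entropy and pressure of self-products -/

section Product

/-- Products of separated sets are separated, so that `2 P(φ) ≤ P(Φ)`. -/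
lemma two_mul_le_topPressure_prodFlow {X : Type*} [MetricSpace X] {F : Flow ℝ X}
    {φ : X → ℝ} (hφ : Continuous φ) {c : ℝ}
    (hc : (c : EReal) < topPressure F φ) :
    ((2 * c : ℝ) : EReal) ≤ topPressure (prodFlow F) (prodPotential φ) := by
  obtain ⟨ε, hε⟩ := lt_iSup_iff.1 hc
  obtain ⟨hε0, hε⟩ := lt_iSup_iff.1 hε
  refine le_trans ?_ (le_iSup₂ (f := fun (ε : ℝ) (_ : 0 < ε) =>
    pressureAtScale (prodFlow F) (prodPotential φ) ε) ε hε0)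
  refine le_limsup_of_frequently_le
    (((frequently_lt_of_lt_limsup (by isBoundedDefault) hε).and_eventually
      (eventually_gt_atTop (0 : ℝ))).mono ?_)
  rintro t ⟨ht, ht0⟩
  refine le_of_lt ?_
  rw [lt_log_div_iff ht0] at ht ⊢
  obtain ⟨E, hE⟩ := lt_iSup_iff.1 ht
  obtain ⟨hEs, hE⟩ := lt_iSup_iff.1 hE
  have hsep : IsSeparated (prodFlow F) t ε ((E ×ˢ E : Finset (X × X)) : Set (X × X)) := by
    rintro ⟨a, b⟩ hab ⟨a', b'⟩ hab' hne
    simp only [Finset.coe_product, mem_prod, Finset.mem_coe] at hab hab'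
    by_cases h : a = a'
    · have hb : b ≠ b' := fun hb => hne (by rw [h, hb])
      obtain ⟨s, hs, hd⟩ := hEs b hab.2 b' hab'.2 hb
      exact ⟨s, hs, hd.trans (le_max_right _ _)⟩
    · obtain ⟨s, hs, hd⟩ := hEs a hab.1 a' hab'.1 h
      exact ⟨s, hs, hd.trans (le_max_left _ _)⟩
  refine lt_of_lt_of_le ?_ (le_iSup₂ (f := fun (E : Finset (X × X))
    (_ : IsSeparated (prodFlow F) t ε (E : Set (X × X))) => ∑ x ∈ E, ENNReal.ofReal (Real.exp
      (∫ s in (0 : ℝ)..t, prodPotential φ (prodFlow F s x)))) (E ×ˢ E) hsep)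
  have hci : ∀ y, IntervalIntegrable (fun s => φ (F s y)) volume 0 t := fun y =>
    (hφ.comp (F.continuous continuous_id continuous_const)).intervalIntegrable _ _
  have hterm : ∀ p : X × X, ∫ s in (0 : ℝ)..t, prodPotential φ (prodFlow F s p) =
      (∫ s in (0 : ℝ)..t, φ (F s p.1)) + ∫ s in (0 : ℝ)..t, φ (F s p.2) := fun p =>
    intervalIntegral.integral_add (hci _) (hci _)
  simp only [hterm, Real.exp_add, ENNReal.ofReal_mul (Real.exp_pos _).le]
  rw [Finset.sum_product]
  dsimp only
  rw [← Finset.sum_mul_sum]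
  have e : Real.exp (2 * c * t) = Real.exp (c * t) * Real.exp (c * t) := by
    rw [← Real.exp_add]; congr 1; ring
  rw [e, ENNReal.ofReal_mul (Real.exp_pos _).le]
  exact ENNReal.mul_lt_mul hE hE

lemma IsInvariantProb.map {X Y : Type*} [TopologicalSpace X] [MeasurableSpace X]
    [TopologicalSpace Y] [MeasurableSpace Y] {F : Flow ℝ X} {G : Flow ℝ Y} {μ : Measure X}
    (hμ : IsInvariantProb F μ) {π : X → Y} (hπ : Measurable π) (hG : ∀ t, Measurable (G t))
    (h : ∀ t x, π (F t x) = G t (π x)) : IsInvariantProb G (μ.map π) where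
  isProbabilityMeasure := by
    have := hμ.isProbabilityMeasure
    exact Measure.isProbabilityMeasure_map hπ.aemeasurable
  measurePreserving t := by
    refine ⟨hG t, ?_⟩
    rw [Measure.map_map (hG t) hπ]
    have : G t ∘ π = π ∘ F t := by ext x; exact (h t x).symm
    rw [this, ← Measure.map_map hπ (hμ.measurePreserving t).measurable,
      (hμ.measurePreserving t).map_eq]

lemma IsInvariantProb.map_fst {X : Type*} [MetricSpace X] [MeasurableSpace X] [BorelSpace X]
    {F : Flow ℝ X} {ν : Measure (X × X)} (hν : IsInvariantProb (prodFlow F) ν) :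
    IsInvariantProb F (ν.map Prod.fst) :=
  hν.map measurable_fst (fun t => (F.continuous_toFun t).measurable) fun _ _ => rfl

lemma IsInvariantProb.map_snd {X : Type*} [MetricSpace X] [MeasurableSpace X] [BorelSpace X]
    {F : Flow ℝ X} {ν : Measure (X × X)} (hν : IsInvariantProb (prodFlow F) ν) :
    IsInvariantProb F (ν.map Prod.snd) :=
  hν.map measurable_snd (fun t => (F.continuous_toFun t).measurable) fun _ _ => rfl

variable {X : Type*} [MetricSpace X] [CompactSpace X] [MeasurableSpace X] [BorelSpace X]
  {F : Flow ℝ X} {ν : Measure (X × X)}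

/-- The entropy of a joining of two invariant measures is at most the sum of their entropies: by
`exists_condEntropy_le_of_dist_lt`, it can be computed with partitions into products. -/
lemma entropy_prodFlow_le (hν : IsInvariantProb (prodFlow F) ν) :
    entropy ν (prodFlow F 1) ≤
      entropy (ν.map Prod.fst) (F 1) + entropy (ν.map Prod.snd) (F 1) := by
  have := hν.isProbabilityMeasure
  have i1 := hν.map_fst.isProbabilityMeasure
  have i2 := hν.map_snd.isProbabilityMeasure
  have hT := hν.measurePreserving 1
  have hT1 := hν.map_fst.measurePreserving 1
  have n1 := entropy_nonneg (μ := ν.map Prod.fst) (T := F 1)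
  have n2 := entropy_nonneg (μ := ν.map Prod.snd) (T := F 1)
  rcases eq_or_ne (entropy (ν.map Prod.fst) (F 1)) ⊤ with ht1 | ht1
  · rw [ht1, EReal.top_add_of_ne_bot (ne_bot_of_le_ne_bot EReal.zero_ne_bot n2)]
    exact le_top
  rcases eq_or_ne (entropy (ν.map Prod.snd) (F 1)) ⊤ with ht2 | ht2
  · rw [ht2, EReal.add_top_of_ne_bot (ne_bot_of_le_ne_bot EReal.zero_ne_bot n1)]
    exact le_top
  lift entropy (ν.map Prod.fst) (F 1) to ℝ using
    ⟨ht1, ne_bot_of_le_ne_bot EReal.zero_ne_bot n1⟩ with h₁ hh1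
  lift entropy (ν.map Prod.snd) (F 1) to ℝ using
    ⟨ht2, ne_bot_of_le_ne_bot EReal.zero_ne_bot n2⟩ with h₂ hh2
  refine iSup_le fun k => iSup_le fun ξ => iSup_le fun hξ =>
    EReal.le_of_forall_lt_iff_le.1 fun q hq => ?_
  rw [← EReal.coe_add, EReal.coe_lt_coe_iff] at hq
  set ε := (q - (h₁ + h₂)) / 3 with hε
  have hε0 : 0 < ε := by linarith
  obtain ⟨δ, hδ, hcond⟩ := exists_condEntropy_le_of_dist_lt ν hξ hε0
  obtain ⟨k₀, α, hα, hαd⟩ := exists_partition_dist_lt (X := X) hδ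
  set β : X × X → Fin k₀ × Fin k₀ := fun p => (α p.1, α p.2) with hβ
  have hβm : Measurable β := (hα.comp measurable_fst).prodMk (hα.comp measurable_snd)
  have hc := hcond β hβm fun p p' h => by
    rw [Prod.dist_eq]
    exact max_lt (hαd _ _ (congrArg Prod.fst h)) (hαd _ _ (congrArg Prod.snd h))
  have hr : ∀ (μ : Measure X) [IsProbabilityMeasure μ] (h : ℝ), (h : EReal) = entropy μ (F 1) →
      ∀ᶠ n : ℕ in atTop, partitionEntropy μ (refinement (F 1) α n) ≤ n * (h + ε) := by
    intro μ _ h hh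
    refine eventually_partitionEntropy_le_of_rate_lt
      ((partitionEntropyRate_le_entropy hT1.measurable hα).trans_lt ?_)
    rw [← hh, EReal.coe_lt_coe_iff]
    linarith
  refine partitionEntropyRate_le_of_eventually_le hT.measurable hξ (b := 0) ?_
  filter_upwards [hr (ν.map Prod.fst) h₁ hh1, hr (ν.map Prod.snd) h₂ hh2] with n e1 e2
  have hαn := measurable_refinement hT1.measurable hα n
  rw [← partitionEntropy_comp_measurePreserving (measurable_fst.measurePreserving ν) hαn] at e1
  rw [← partitionEntropy_comp_measurePreserving (measurable_snd.measurePreserving ν) hαn] at e2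
  have m1 := hαn.comp (measurable_fst : Measurable (Prod.fst : X × X → X))
  have m2 := hαn.comp (measurable_snd : Measurable (Prod.snd : X × X → X))
  have s1 := partitionEntropy_refinement_le_add hT hξ hβm n
  have hit : ∀ (i : ℕ) (p : X × X), (prodFlow F 1)^[i] p = ((F 1)^[i] p.1, (F 1)^[i] p.2) := by
    intro i p
    rw [flow_one_iterate, flow_one_iterate, flow_one_iterate]
    rfl
  have s2 : partitionEntropy ν (refinement (prodFlow F 1) β n) ≤
      partitionEntropy ν (fun p => ((refinement (F 1) α n ∘ Prod.fst) p,
        (refinement (F 1) α n ∘ Prod.snd) p)) :=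
    partitionEntropy_le_of_factor (m1.prodMk m2) (fun y i => (y.1 i, y.2 i)) fun p => by
      funext i
      simp [refinement, hit, hβ]
  have s3 := partitionEntropy_pair_le (μ := ν) m1 m2
  have s4 := mul_le_mul_of_nonneg_left hc (Nat.cast_nonneg (α := ℝ) n)
  have s5 : (n : ℝ) * q = n * (h₁ + ε) + n * (h₂ + ε) + n * ε := by
    rw [← mul_add, ← mul_add]; congr 1; rw [hε]; ring
  linarith

lemma measurePressure_prodFlow_le {φ : X → ℝ} (hφ : Continuous φ)
    (hν : IsInvariantProb (prodFlow F) ν) :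
    measurePressure (prodFlow F) (prodPotential φ) ν ≤
      measurePressure F φ (ν.map Prod.fst) + measurePressure F φ (ν.map Prod.snd) := by
  have := hν.isProbabilityMeasure
  have h : ∫ p, prodPotential φ p ∂ν =
      ∫ x, φ x ∂(ν.map Prod.fst) + ∫ x, φ x ∂(ν.map Prod.snd) := by
    rw [integral_map measurable_fst.aemeasurable hφ.aestronglyMeasurable,
      integral_map measurable_snd.aemeasurable hφ.aestronglyMeasurable,
      ← integral_add (integrable_of_continuous (by fun_prop))
        (integrable_of_continuous (by fun_prop))]
    rfl
  unfold measurePressure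
  rw [h, EReal.coe_add]
  refine (add_le_add_left (entropy_prodFlow_le hν) _).trans (le_of_eq ?_)
  exact add_add_add_comm _ _ _ _

end Product

/-! ### Splitting along an invariant set -/

section Split

open ProbabilityTheory

lemma IsInvariantProb.cond {X : Type*} [TopologicalSpace X] [MeasurableSpace X] {F : Flow ℝ X}
    {μ : Measure X} (hμ : IsInvariantProb F μ) {B : Set X} (hB : MeasurableSet B)
    (hinv : ∀ t, F t ⁻¹' B = B) (h0 : μ B ≠ 0) : IsInvariantProb F (μ[|B]) where
  isProbabilityMeasure := by
    have := hμ.isProbabilityMeasure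
    exact cond_isProbabilityMeasure h0
  measurePreserving t := by
    have h := (hμ.measurePreserving t).restrict_preimage hB
    rw [hinv t] at h
    exact h.smul_measure _

variable {X : Type*} [MeasurableSpace X] {μ : Measure X} [IsProbabilityMeasure μ]

lemma measureReal_eq_cond_add_cond_compl {B : Set X} (hB : MeasurableSet B) (A : Set X) :
    μ.real A = μ.real B * (μ[|B]).real A + μ.real Bᶜ * (μ[|Bᶜ]).real A := by
  have h : ∀ {B : Set X}, MeasurableSet B → μ.real B * (μ[|B]).real A = μ.real (B ∩ A) := by
    intro B hB
    rw [Measure.real, Measure.real, ← ENNReal.toReal_mul, mul_comm, cond_mul_eq_inter hB]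
    rfl
  rw [h hB, h hB.compl, inter_comm B, inter_comm Bᶜ, ← Set.sdiff_eq]
  exact (measureReal_inter_add_sdiff hB).symm

/-- Entropy of a partition is convex up to a bounded error, which disappears in the entropy rate. -/
lemma partitionEntropy_le_cond_add {ι : Type*} [Fintype ι] [MeasurableSpace ι]
    [MeasurableSingletonClass ι] {B : Set X} (hB : MeasurableSet B) {ξ : X → ι}
    (hξ : Measurable ξ) :
    partitionEntropy μ ξ ≤ μ.real B * partitionEntropy (μ[|B]) ξ +
      μ.real Bᶜ * partitionEntropy (μ[|Bᶜ]) ξ + 2 := by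
  have key : ∀ B : Set X, ∑ j, Real.negMulLog (μ.real B * (μ[|B]).real (ξ ⁻¹' {j})) ≤
      μ.real B * partitionEntropy (μ[|B]) ξ + 1 := by
    intro B
    simp only [Real.negMulLog_mul, Finset.sum_add_distrib, ← Finset.sum_mul, ← Finset.mul_sum]
    rw [add_comm]
    refine add_le_add le_rfl ?_
    rcases eq_or_ne (μ B) 0 with h0 | h0
    · simp [Measure.real, h0]
    · have := cond_isProbabilityMeasure h0
      rw [sum_real_fibre hξ, one_mul]
      have := Real.negMulLog_le_one_sub_self (measureReal_nonneg (μ := μ) (s := B))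
      have := measureReal_nonneg (μ := μ) (s := B)
      linarith
  have h1 : partitionEntropy μ ξ ≤
      ∑ j, (Real.negMulLog (μ.real B * (μ[|B]).real (ξ ⁻¹' {j})) +
        Real.negMulLog (μ.real Bᶜ * (μ[|Bᶜ]).real (ξ ⁻¹' {j}))) := by
    refine Finset.sum_le_sum fun j _ => ?_
    rw [measureReal_eq_cond_add_cond_compl hB]
    have := negMulLog_sum_le Finset.univ
      ![μ.real B * (μ[|B]).real (ξ ⁻¹' {j}), μ.real Bᶜ * (μ[|Bᶜ]).real (ξ ⁻¹' {j})]
      (fun i _ => by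
        fin_cases i
        · exact mul_nonneg measureReal_nonneg measureReal_nonneg
        · exact mul_nonneg measureReal_nonneg measureReal_nonneg)
    simpa using this
  rw [Finset.sum_add_distrib] at h1
  have := key B
  have := key Bᶜ
  linarith

lemma integral_eq_cond_add_cond_compl {B : Set X} (hB : MeasurableSet B) {φ : X → ℝ}
    (hφ : Integrable φ μ) :
    ∫ x, φ x ∂μ = μ.real B * ∫ x, φ x ∂(μ[|B]) + μ.real Bᶜ * ∫ x, φ x ∂(μ[|Bᶜ]) := by
  have h : ∀ B : Set X, μ.real B * ∫ x, φ x ∂(μ[|B]) = ∫ x in B, φ x ∂μ := by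
    intro B
    rw [ProbabilityTheory.cond, integral_smul_measure, ENNReal.toReal_inv, smul_eq_mul,
      ← mul_assoc]
    rcases eq_or_ne (μ B) 0 with h0 | h0
    · simp [Measure.real, h0, Measure.restrict_eq_zero.2 h0]
    · have : μ.real B ≠ 0 := by simpa [measureReal_eq_zero_iff] using h0
      rw [← Measure.real, mul_inv_cancel₀ this, one_mul]
  rw [h, h, integral_add_compl hB hφ]

/-- Measure-theoretic pressure is convex with respect to a splitting along an invariant set. -/
lemma measurePressure_le_of_cond_le {X : Type*} [TopologicalSpace X] [MeasurableSpace X]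
    {F : Flow ℝ X} {μ : Measure X} (hμ : IsInvariantProb F μ) {φ : X → ℝ} (hφ : Integrable φ μ)
    {B : Set X} (hB : MeasurableSet B) {c c' : ℝ}
    (h : μ B ≠ 0 → measurePressure F φ (μ[|B]) ≤ (c : EReal))
    (h' : μ Bᶜ ≠ 0 → measurePressure F φ (μ[|Bᶜ]) ≤ (c' : EReal)) :
    measurePressure F φ μ ≤ ((μ.real B * c + μ.real Bᶜ * c' : ℝ) : EReal) := by
  have := hμ.isProbabilityMeasure
  have hT := (hμ.measurePreserving 1).measurable
  have key : ∀ {B : Set X} {c : ℝ}, (μ B ≠ 0 → measurePressure F φ (μ[|B]) ≤ (c : EReal)) →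
      ∀ {k : ℕ} {ξ : X → Fin k}, Measurable ξ → ∀ {τ : ℝ}, 0 < τ → ∀ᶠ n : ℕ in atTop,
        μ.real B * partitionEntropy (μ[|B]) (refinement (F 1) ξ n) ≤
          n * (μ.real B * (c - ∫ x, φ x ∂(μ[|B]) + τ)) := by
    intro B c h k ξ hξ τ hτ
    rcases eq_or_ne (μ B) 0 with h0 | h0
    · simp [Measure.real, h0]
    have := cond_isProbabilityMeasure h0
    have h1 : entropy (μ[|B]) (F 1) ≤ ((c - ∫ x, φ x ∂(μ[|B]) : ℝ) : EReal) := by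
      rw [EReal.coe_sub]
      exact EReal.le_sub_iff_add_le (Or.inl (EReal.coe_ne_bot _)) (Or.inl (EReal.coe_ne_top _))
        |>.2 (h h0)
    have h2 : partitionEntropyRate (μ[|B]) (F 1) ξ <
        ((c - ∫ x, φ x ∂(μ[|B]) + τ : ℝ) : EReal) := by
      refine ((partitionEntropyRate_le_entropy hT hξ).trans h1).trans_lt ?_
      rw [EReal.coe_lt_coe_iff]; linarith
    filter_upwards [eventually_partitionEntropy_le_of_rate_lt h2] with n hn
    have := mul_le_mul_of_nonneg_left hn (measureReal_nonneg (μ := μ) (s := B))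
    linarith
  suffices hs : entropy μ (F 1) ≤
      ((μ.real B * c + μ.real Bᶜ * c' - ∫ x, φ x ∂μ : ℝ) : EReal) by
    refine (add_le_add_left hs _).trans (le_of_eq ?_)
    rw [← EReal.coe_add, sub_add_cancel]
  refine iSup_le fun k => iSup_le fun ξ => iSup_le fun hξ =>
    EReal.le_of_forall_lt_iff_le.1 fun q hq => ?_
  rw [EReal.coe_lt_coe_iff] at hq
  set τ := q - (μ.real B * c + μ.real Bᶜ * c' - ∫ x, φ x ∂μ) with hτ
  have hτ0 : 0 < τ := by linarith
  refine partitionEntropyRate_le_of_eventually_le hT hξ (b := 2) ?_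
  filter_upwards [key h hξ hτ0, key h' hξ hτ0] with n h1 h2
  have h3 := partitionEntropy_le_cond_add (μ := μ) hB (measurable_refinement hT hξ n)
  have h4 := integral_eq_cond_add_cond_compl hB hφ
  have h5 : μ.real B + μ.real Bᶜ = 1 := by rw [probReal_compl_eq_one_sub hB]; ring
  have h6 : (n : ℝ) * q = n * (μ.real B * (c - ∫ x, φ x ∂(μ[|B]) + τ)) +
      n * (μ.real Bᶜ * (c' - ∫ x, φ x ∂(μ[|Bᶜ]) + τ)) := by
    rw [← mul_add]
    congr 1
    linear_combination hτ - h4 - τ * h5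
  linarith

end Split

/-! ### Product expansivity -/

section ProductExpansive

open ProbabilityTheory

lemma prodNonExpansiveSet_mono {X : Type*} [MetricSpace X] {F : Flow ℝ X} {ε ε' : ℝ}
    (h : ε ≤ ε') : prodNonExpansiveSet F ε ⊆ prodNonExpansiveSet F ε' := fun _ hp s hs hsub =>
  hp s hs (Subset.trans (fun _ hy t => (hy t).trans h) hsub)

lemma prodNonExpansiveSet_subset {X : Type*} [MetricSpace X] (F : Flow ℝ X) (ε : ℝ) :
    prodNonExpansiveSet F ε ⊆
      Prod.fst ⁻¹' nonExpansiveSet F ε ∪ Prod.snd ⁻¹' nonExpansiveSet F ε := by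
  rintro ⟨x, y⟩ hp
  by_contra hcon
  simp only [nonExpansiveSet, mem_union, mem_preimage, mem_ofPred_eq, not_or, not_forall,
    not_not] at hcon
  obtain ⟨⟨s, hs, hx⟩, s', -, hy⟩ := hcon
  refine hp (max s s') (lt_max_of_lt_left hs) ?_
  rintro ⟨x', y'⟩ h
  exact ⟨orbitSegment_mono x (le_max_left _ _) (hx fun t => (le_max_left _ _).trans (h t)),
    orbitSegment_mono y (le_max_right _ _) (hy fun t => (le_max_right _ _).trans (h t))⟩

lemma measure_prodNonExpansiveSet_ne_zero {X : Type*} [MetricSpace X] [MeasurableSpace X]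
    {F : Flow ℝ X} {ν : Measure (X × X)} (h : ¬ IsProductExpansive F ν) {ε : ℝ} (hε : 0 < ε) :
    ν (prodNonExpansiveSet F ε) ≠ 0 := by
  obtain ⟨ε', h1, h2⟩ := ((not_eventually.1 h).and_eventually
    (Ioo_mem_nhdsGT hε : Ioo 0 ε ∈ 𝓝[>] (0 : ℝ))).exists
  exact fun h0 => h1 (measure_mono_null (prodNonExpansiveSet_mono h2.2.le) h0)

/-- A measure that is not product expansive charges the points with one of the two coordinates
non-expansive. -/
lemma measure_preimage_nonExpansiveSet_ne_zero {X : Type*} [MetricSpace X] [MeasurableSpace X]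
    {F : Flow ℝ X} {ν : Measure (X × X)} (h : ¬ IsProductExpansive F ν) {ε : ℝ} (hε : 0 < ε) :
    ν (Prod.fst ⁻¹' nonExpansiveSet F ε) ≠ 0 ∨ ν (Prod.snd ⁻¹' nonExpansiveSet F ε) ≠ 0 := by
  by_contra! hcon
  exact measure_prodNonExpansiveSet_ne_zero h hε
    (measure_mono_null (prodNonExpansiveSet_subset F ε) (measure_union_null hcon.1 hcon.2))

variable {X : Type*} [MetricSpace X] [CompactSpace X] [MeasurableSpace X] [BorelSpace X]
  {F : Flow ℝ X}

lemma measurePressure_le_obstructionPressure {X : Type*} [MetricSpace X] [MeasurableSpace X]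
    {F : Flow ℝ X} {φ : X → ℝ} {μ : Measure X}
    (hμ : IsInvariantProb F μ) (h : ∀ ε > 0, μ (nonExpansiveSet F ε) = 1) :
    measurePressure F φ μ ≤ obstructionPressure F φ :=
  le_iInf₂ fun ε hε => le_iSup_of_le μ (le_iSup_of_le hμ (le_iSup_of_le (h ε hε) le_rfl))

/-- An ergodic measure which is not product expansive has a marginal carried by the non-expansive
points at every scale. -/
lemma IsErgodicProb.map_nonExpansiveSet_eq_one {ν : Measure (X × X)}
    (hν : IsErgodicProb (prodFlow F) ν) (h : ¬ IsProductExpansive F ν) :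
    (∀ ε > 0, ν.map Prod.fst (nonExpansiveSet F ε) = 1) ∨
      ∀ ε > 0, ν.map Prod.snd (nonExpansiveSet F ε) = 1 := by
  have m := measurableSet_nonExpansiveSet F
  have e1 : ∀ ε, ν.map Prod.fst (nonExpansiveSet F ε) = ν (Prod.fst ⁻¹' nonExpansiveSet F ε) :=
    fun ε => Measure.map_apply measurable_fst (m ε)
  have e2 : ∀ ε, ν.map Prod.snd (nonExpansiveSet F ε) = ν (Prod.snd ⁻¹' nonExpansiveSet F ε) :=
    fun ε => Measure.map_apply measurable_snd (m ε)
  have z1 : ∀ ε, ν.map Prod.fst (nonExpansiveSet F ε) ≠ 0 →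
      ν.map Prod.fst (nonExpansiveSet F ε) = 1 := fun ε h => by
    rw [e1] at h ⊢
    exact (hν.zero_or_one _ (measurable_fst (m ε)) fun t =>
      congrArg (Prod.fst ⁻¹' ·) (preimage_nonExpansiveSet F ε t)).resolve_left h
  have z2 : ∀ ε, ν.map Prod.snd (nonExpansiveSet F ε) ≠ 0 →
      ν.map Prod.snd (nonExpansiveSet F ε) = 1 := fun ε h => by
    rw [e2] at h ⊢
    exact (hν.zero_or_one _ (measurable_snd (m ε)) fun t =>
      congrArg (Prod.snd ⁻¹' ·) (preimage_nonExpansiveSet F ε t)).resolve_left h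
  by_contra! hcon
  obtain ⟨⟨ε₁, h₁, hn₁⟩, ε₂, h₂, hn₂⟩ := hcon
  have a1 := not_imp_comm.1 (z1 ε₁) hn₁
  have a2 := not_imp_comm.1 (z2 ε₂) hn₂
  have hε : 0 < min ε₁ ε₂ := lt_min h₁ h₂
  rcases measure_preimage_nonExpansiveSet_ne_zero h hε with h0 | h0
  · rw [← e1] at h0
    exact h0 (measure_mono_null (nonExpansiveSet_mono (min_le_left _ _)) a1)
  · rw [← e2] at h0
    exact h0 (measure_mono_null (nonExpansiveSet_mono (min_le_right _ _)) a2)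

/-- One marginal contributes at most the obstruction pressure, the other at most `P(φ)`. -/
theorem measurePressure_le_of_not_isProductExpansive {φ : X → ℝ} (hφ : Continuous φ)
    {ν : Measure (X × X)} (hν : IsErgodicProb (prodFlow F) ν) (h : ¬ IsProductExpansive F ν) :
    measurePressure (prodFlow F) (prodPotential φ) ν ≤
      obstructionPressure F φ + topPressure F φ := by
  have hi := hν.toIsInvariantProb
  refine (measurePressure_prodFlow_le hφ hi).trans ?_
  rcases hν.map_nonExpansiveSet_eq_one h with h1 | h1
  · exact add_le_add (measurePressure_le_obstructionPressure hi.map_fst h1)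
      (measurePressure_le_topPressure hφ hi.map_snd)
  · rw [add_comm]
    exact add_le_add (measurePressure_le_obstructionPressure hi.map_snd h1)
      (measurePressure_le_topPressure hφ hi.map_fst)

/-- If the measures on the non-expansive set at some scale have bounded pressure, then every
invariant measure has finite pressure. -/
lemma measurePressure_lt_top {φ : X → ℝ} (hφ : Continuous φ) {ε c : ℝ} (hε : 0 < ε)
    (hc : ∀ μ : Measure X, IsInvariantProb F μ → μ (nonExpansiveSet F ε) = 1 →
      measurePressure F φ μ ≤ (c : EReal))
    {μ : Measure X} (hμ : IsInvariantProb F μ) : measurePressure F φ μ < ⊤ := by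
  have := hμ.isProbabilityMeasure
  have hB := measurableSet_nonExpansiveSet F ε
  have hinv := preimage_nonExpansiveSet F ε
  have hinv' : ∀ t, F t ⁻¹' (nonExpansiveSet F ε)ᶜ = (nonExpansiveSet F ε)ᶜ := fun t => by
    rw [preimage_compl, hinv]
  obtain ⟨c', hc'⟩ : ∃ c' : ℝ, μ (nonExpansiveSet F ε)ᶜ ≠ 0 →
      measurePressure F φ (μ[|(nonExpansiveSet F ε)ᶜ]) ≤ (c' : EReal) := by
    by_cases h0 : μ (nonExpansiveSet F ε)ᶜ = 0
    · exact ⟨0, fun h => absurd h0 h⟩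
    have hi := hμ.cond hB.compl hinv' h0
    have hz : μ[|(nonExpansiveSet F ε)ᶜ] (nonExpansiveSet F ε) = 0 := by
      rw [cond_apply hB.compl, compl_inter_self, measure_empty, mul_zero]
    have hlt : measurePressure F φ (μ[|(nonExpansiveSet F ε)ᶜ]) < ⊤ :=
      EReal.add_lt_top (entropy_lt_top_of_measure_nonExpansiveSet_eq_zero hi hε hz).ne
        (EReal.coe_ne_top _)
    obtain ⟨c', hc', -⟩ := EReal.lt_iff_exists_real_btwn.1 hlt
    exact ⟨c', fun _ => hc'.le⟩
  refine (measurePressure_le_of_cond_le hμ (integrable_of_continuous hφ) hB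
    (fun h0 => hc _ (hμ.cond hB hinv h0) (cond_apply_self h0 (measure_ne_top _ _)))
    hc').trans_lt (EReal.coe_lt_top _)

/-- The pressure gap forces equilibrium states to be product expansive: conditioning on an invariant
set of non-expansive points would lose pressure. -/
theorem IsEquilibriumState.isProductExpansive {φ : X → ℝ} (hφ : Continuous φ)
    (hgap : obstructionPressure F φ < topPressure F φ) {ν : Measure (X × X)}
    (hν : IsEquilibriumState (prodFlow F) (prodPotential φ) ν) : IsProductExpansive F ν := by
  obtain ⟨hi, heq⟩ := hν
  have := hi.isProbabilityMeasure
  by_contra hne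
  obtain ⟨ε, hε⟩ := iInf_lt_iff.1 hgap
  obtain ⟨hε0, hε⟩ := iInf_lt_iff.1 hε
  obtain ⟨s, hs, hsP⟩ := EReal.lt_iff_exists_real_btwn.1 hε
  have hobs : ∀ μ : Measure X, IsInvariantProb F μ → μ (nonExpansiveSet F ε) = 1 →
      measurePressure F φ μ ≤ (s : EReal) := fun μ hμ h => by
    refine le_trans ?_ hs.le
    exact le_iSup_of_le μ (le_iSup_of_le hμ (le_iSup_of_le h le_rfl))
  -- the topological pressure of `φ` is finite
  have hΦtop : topPressure (prodFlow F) (prodPotential φ) < ⊤ := by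
    rw [← heq]
    exact (measurePressure_prodFlow_le hφ hi).trans_lt (EReal.add_lt_top
      (measurePressure_lt_top hφ hε0 hobs hi.map_fst).ne
      (measurePressure_lt_top hφ hε0 hobs hi.map_snd).ne)
  have htop : topPressure F φ ≠ ⊤ := by
    intro ht
    obtain ⟨q, hq, -⟩ := EReal.lt_iff_exists_real_btwn.1 hΦtop
    have := two_mul_le_topPressure_prodFlow (F := F) hφ (c := q / 2)
      (by rw [ht]; exact EReal.coe_lt_top _)
    rw [mul_div_cancel₀ q two_ne_zero] at this
    exact absurd hq (not_lt.2 this)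
  obtain ⟨p, hp⟩ : ∃ p : ℝ, (p : EReal) = topPressure F φ :=
    ⟨_, EReal.coe_toReal htop (ne_bot_of_gt hsP)⟩
  have hsp : s < p := by rwa [← hp, EReal.coe_lt_coe_iff] at hsP
  have h2p : ((2 * p : ℝ) : EReal) ≤ measurePressure (prodFlow F) (prodPotential φ) ν := by
    rw [heq]
    refine EReal.ge_of_forall_gt_iff_ge.1 fun z hz => ?_
    rw [EReal.coe_lt_coe_iff] at hz
    have := two_mul_le_topPressure_prodFlow (F := F) hφ (c := z / 2)
      (by rw [← hp, EReal.coe_lt_coe_iff]; linarith)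
    rwa [mul_div_cancel₀ z two_ne_zero] at this
  have hvar : ∀ μ : Measure X, IsInvariantProb F μ → measurePressure F φ μ ≤ (p : EReal) :=
    fun μ hμ => hp ▸ measurePressure_le_topPressure hφ hμ
  -- an invariant set of positive measure on which the pressure is smaller gives a contradiction
  have hcontra : ∀ B : Set (X × X), MeasurableSet B → (∀ t, prodFlow F t ⁻¹' B = B) →
      ν B ≠ 0 →
      ¬ measurePressure (prodFlow F) (prodPotential φ) (ν[|B]) ≤ ((s + p : ℝ) : EReal) := by
    intro B hB hinv h0 hle
    have hinv' : ∀ t, prodFlow F t ⁻¹' Bᶜ = Bᶜ := fun t => by rw [preimage_compl, hinv]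
    have h1 := measurePressure_le_of_cond_le hi (φ := prodPotential φ) (c := s + p) (c' := p + p)
      (integrable_of_continuous ((hφ.comp continuous_fst).add (hφ.comp continuous_snd))) hB
      (fun _ => hle) (fun h => by
        have hc := hi.cond hB.compl hinv' h
        rw [EReal.coe_add]
        exact (measurePressure_prodFlow_le hφ hc).trans
          (add_le_add (hvar _ hc.map_fst) (hvar _ hc.map_snd)))
    have h2 := h2p.trans h1
    rw [EReal.coe_le_coe_iff, probReal_compl_eq_one_sub hB] at h2
    have h3 : 0 < ν.real B := ENNReal.toReal_pos h0 (measure_ne_top _ _)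
    nlinarith
  have m := measurableSet_nonExpansiveSet F ε
  rcases measure_preimage_nonExpansiveSet_ne_zero hne hε0 with h0 | h0
  · have hB : MeasurableSet ((Prod.fst : X × X → X) ⁻¹' nonExpansiveSet F ε) := measurable_fst m
    have hinv : ∀ t, prodFlow F t ⁻¹' (Prod.fst ⁻¹' nonExpansiveSet F ε) =
        Prod.fst ⁻¹' nonExpansiveSet F ε := fun t =>
      congrArg (Prod.fst ⁻¹' ·) (preimage_nonExpansiveSet F ε t)
    have hc := hi.cond hB hinv h0
    refine hcontra _ hB hinv h0 ((measurePressure_prodFlow_le hφ hc).trans ?_)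
    rw [EReal.coe_add]
    refine add_le_add (hobs _ hc.map_fst ?_) (hvar _ hc.map_snd)
    rw [Measure.map_apply measurable_fst m]
    exact cond_apply_self h0 (measure_ne_top _ _)
  · have hB : MeasurableSet ((Prod.snd : X × X → X) ⁻¹' nonExpansiveSet F ε) := measurable_snd m
    have hinv : ∀ t, prodFlow F t ⁻¹' (Prod.snd ⁻¹' nonExpansiveSet F ε) =
        Prod.snd ⁻¹' nonExpansiveSet F ε := fun t =>
      congrArg (Prod.snd ⁻¹' ·) (preimage_nonExpansiveSet F ε t)
    have hc := hi.cond hB hinv h0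
    refine hcontra _ hB hinv h0 ((measurePressure_prodFlow_le hφ hc).trans ?_)
    rw [add_comm s p, EReal.coe_add]
    refine add_le_add (hvar _ hc.map_fst) (hobs _ hc.map_snd ?_)
    rw [Measure.map_apply measurable_snd m]
    exact cond_apply_self h0 (measure_ne_top _ _)

end ProductExpansive

end FlowPressure

theorem mainTheorem9 {X : Type*} [MetricSpace X] [CompactSpace X] [MeasurableSpace X]
    [BorelSpace X] (F : Flow ℝ X) (φ : X → ℝ) (hφ : Continuous φ) :
    (∀ ν : Measure (X × X),
      FlowPressure.IsErgodicProb (FlowPressure.prodFlow F) ν →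
      ¬ FlowPressure.IsProductExpansive F ν →
      FlowPressure.measurePressure (FlowPressure.prodFlow F) (FlowPressure.prodPotential φ) ν
        ≤ FlowPressure.obstructionPressure F φ + FlowPressure.topPressure F φ) ∧
    (FlowPressure.obstructionPressure F φ < FlowPressure.topPressure F φ →
      ∀ ν : Measure (X × X),
        FlowPressure.IsEquilibriumState (FlowPressure.prodFlow F)
          (FlowPressure.prodPotential φ) ν →
        FlowPressure.IsProductExpansive F ν) := by
  exact ⟨fun _ hν h => FlowPressure.measurePressure_le_of_not_isProductExpansive hφ hν h,
    fun hgap _ hν => hν.isProductExpansive hφ hgap⟩
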